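/- Let $\tilde A$ be an abelian group and $A\subseteq\tilde A$ a subgroup. Let $V$ be a strongly $A$-graded Möbius or conformal vertex algebra over $\mathbb C$, $V=\coprod_{n\in\mathbb Z,\alpha\in A}V^{(\alpha)}_{(n)}$, and let $W_1,W_2$ be strongly $\tilde A$-graded generalized $V$-modules, $W_i=\coprod_{n\in\mathbb C,\beta\in\tilde A}(W_i)^{(\beta)}_{[n]}$. (Strongly graded means: the homogeneous spaces $V^{(\alpha)}_{(n)}$, $(W_i)^{(\beta)}_{[n]}$ are finite dimensional; $V^{(\alpha)}_{(n)}=0$ for $n$ sufficiently negative, and $(W_i)^{(\beta)}_{[n+k]}=0$ for $k\in\mathbb Z$ sufficiently negative; $\mathbf 1\in V^{(0)}_{(0)}$ and, in the conformal case, $\omega\in V^{(0)}_{(2)}$; the components of vertex operators add the $A$- and $\tilde A$-degrees, and $L(-1),L(0),L(1)$ preserve them. The space $V_{(n)}$ consists of eigenvectors, and $(W_i)_{[n]}$ of generalized eigenvectors, of $L(0)$ with eigenvalue $n$.) Write $Y(v,x)=\sum_{n\in\mathbb Z} v_nx^{-n-1}$ and $Y_i(v,x)=\sum_{n\in\mathbb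 Z}v_nx^{-n-1}$ for the vertex operators on $V$ and on $W_i$, and let $z\in\mathbb C^{\times}$. Let $V\otimes\mathbb C((t))$ act on $W_i$ by $\tau_{W_i}\big(v\otimes\sum_n a_nt^n\big)=\sum_n a_nv_n$. For $v\in V_{(h)}$ put $v^o=(-1)^h\sum_{m\ge0}\frac1{m!}L(1)^mv\otimes t^{-m-2+2h}$, extend linearly to $v\in V$, and let $o:V\otimes\mathbb C((t^{-1}))\to V\otimes\mathbb C((t))$, $v\otimes f(t)\mapsto v^of(t^{-1})$. For $f\in\mathbb C[t,t^{-1},(z+t)^{-1}]$ (identified with its expansion $\iota_+f\in\mathbb C((t))$) let $T^+_{-z}(v\otimes f)=v\otimes f(t-z)$ with $f(t-z)$ expanded in $\mathbb C((t))$, let $T^-_{-z}(v\otimes f)=v\otimes f(t-z)$ with $f(t-z)$ expanded in $\mathbb C((t^{-1}))$, and let $T^o_{-z}=o\circ T^-_{-z}$. Define the linear action $\tau_{Q(z)}$ of $V\otimes\mathbb C[t,t^{-1},(z+t)^{-1}]$ on $(W_1\otimes W_2)^*$ by $$(\tau_{Q(z)}(\xi)\lambda)(w_{1}\otimes w_{2})=\lambda(\tau_{W_1}(T^o_{-z}\xi)w_{1}\otimes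 w_{2})-\lambda(w_{1}\otimes\tau_{W_2}(T^+_{-z}\xi)w_{2}),$$ and put $Y_t(v,x)=\sum_{n\in\mathbb Z}(v\otimes t^n)x^{-n-1}$ and $Y'_{Q(z)}(v,x)=\tau_{Q(z)}(Y_t(v,x))$. Here $\delta(x)=\sum_{n\in\mathbb Z}x^n$, and powers of binomials are expanded in nonnegative powers of the second variable; in particular $$z^{-1}\delta\Big(\frac{x_1-x_0}{z}\Big)Y_t(v,x_0)=v\otimes\Big(\sum_{m\in\mathbb Z}(z+t)^mx_1^{-m-1}\Big)\Big(\sum_{n\in\mathbb Z}t^nx_0^{-n-1}\Big).$$ An element $\lambda\in(W_1\otimes W_2)^*$ satisfies the $Q(z)$-compatibility condition if (a) for every $v\in V$, $Y'_{Q(z)}(v,x)\lambda$ involves only finitely many negative powers of $x$; and (b) for every $v\in V$, $$\tau_{Q(z)}\Big(z^{-1}\delta\Big(\frac{x_1-x_0}{z}\Big)Y_t(v,x_0)\Big)\lambda=z^{-1}\delta\Big(\frac{x_1-x_0}{z}\Big)Y'_{Q(z)}(v,x_0)\lambda .$$ **Theorem.** If $\lambda\in(W_1\otimes W_2)^*$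 satisfies the $Q(z)$-compatibility condition, then the Jacobi identity for $Y'_{Q(z)}$ holds when acting on $\lambda$: for all $u,v\in V$, all three of the following products exist and $$x_0^{-1}\delta\Big(\frac{x_1-x_2}{x_0}\Big)Y'_{Q(z)}(u,x_1)Y'_{Q(z)}(v,x_2)\lambda-x_0^{-1}\delta\Big(\frac{x_2-x_1}{-x_0}\Big)Y'_{Q(z)}(v,x_2)Y'_{Q(z)}(u,x_1)\lambda=x_2^{-1}\delta\Big(\frac{x_1-x_0}{x_2}\Big)Y'_{Q(z)}(Y(u,x_0)v,x_2)\lambda .$$ -/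

import Mathlib

open scoped TensorProduct

noncomputable section

namespace QzTensor

/-! ## Formal calculus -/

/-- Formal Laurent series `∑ₑ f(e) x₀^{e 0} ⋯ x_{k-1}^{e (k-1)}`, infinite in all directions, with
coefficients in `U`. -/
abbrev FormalSeries (k : ℕ) (U : Type*) := (Fin k → ℤ) → U

section FormalCalculus

variable {U V : Type*} [AddCommGroup U] [Module ℂ U] [AddCommGroup V] [Module ℂ V]

/-- The product `f · g` exists: each of its coefficients is a finite sum. -/
def MulDefined {k : ℕ} (f : FormalSeries k ℂ) (g : FormalSeries k U) : Prop :=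
  ∀ e, {p | f p • g (e - p) ≠ 0}.Finite

/-- The product `f · g` of a scalar formal series and a vector-valued one. -/
def formalMul {k : ℕ} (f : FormalSeries k ℂ) (g : FormalSeries k U) : FormalSeries k U :=
  fun e => ∑ᶠ p, f p • g (e - p)

/-- The formal delta function
`x_i⁻¹ δ((x_j - x_k) / (ε x_i)) = ∑ₙ εⁿ (x_j - x_k)ⁿ x_i^{-n-1}`, where `ε = ±1` and `i, j, k`
are distinct; every `(x_j - x_k)ⁿ` is expanded in nonnegative powers of `x_k`. -/
def deltaThree (ε : ℤˣ) (i j k : Fin 3) : FormalSeries 3 ℂ := fun e =>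
  if 0 ≤ e k ∧ e j + e k = -e i - 1 then
    (((ε ^ (-e i - 1) : ℤˣ) : ℤ) : ℂ) * (-1) ^ (e k).toNat *
      ((Ring.choose (-e i - 1) (e k).toNat : ℤ) : ℂ)
  else 0

/-- The formal delta function `z⁻¹ δ((x₁ - x₀) / z) = ∑ₙ z^{-n-1} (x₁ - x₀)ⁿ` for a complex number
`z`; every `(x₁ - x₀)ⁿ` is expanded in nonnegative powers of `x₀`. -/
def deltaTwo (z : ℂ) : FormalSeries 2 ℂ := fun e =>
  if 0 ≤ e 0 then
    z ^ (-(e 0 + e 1) - 1) * (-1) ^ (e 0).toNat * ((Ring.choose (e 0 + e 1) (e 0).toNat : ℤ) : ℂ)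
  else 0

/-- The series `∑_{m,n} F(m,n) x_i^{-m-1} x_j^{-n-1}` as a series in `x₀, x₁, x₂`; here `l` is the
index of the variable that does not occur. -/
def seriesIn (i j l : Fin 3) (F : ℤ → ℤ → U) : FormalSeries 3 U := fun e =>
  if e l = 0 then F (-e i - 1) (-e j - 1) else 0

/-- The Jacobi identity for `u, v` acting on `w`:
`x₀⁻¹ δ((x₁ - x₂)/x₀) Y(u,x₁) Y(v,x₂) w - x₀⁻¹ δ((x₂ - x₁)/(-x₀)) Y(v,x₂) Y(u,x₁) w
  = x₂⁻¹ δ((x₁ - x₀)/x₂) Y(Y_V(u,x₀)v, x₂) w`,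
including the existence of the three products. Here `Y_V(u,x) = ∑ₙ (YV u n) x^{-n-1}` and
`Y(u,x) = ∑ₙ (YU u n) x^{-n-1}`. -/
def Jacobi (YV : V → ℤ → Module.End ℂ V) (YU : V → ℤ → Module.End ℂ U) (u v : V) (w : U) : Prop :=
  MulDefined (deltaThree 1 0 1 2) (seriesIn 1 2 0 fun m n => YU u m (YU v n w)) ∧
  MulDefined (deltaThree (-1) 0 2 1) (seriesIn 1 2 0 fun m n => YU v n (YU u m w)) ∧
  MulDefined (deltaThree 1 2 1 0) (seriesIn 0 2 1 fun l n => YU (YV u l v) n w) ∧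
  formalMul (deltaThree 1 0 1 2) (seriesIn 1 2 0 fun m n => YU u m (YU v n w)) -
    formalMul (deltaThree (-1) 0 2 1) (seriesIn 1 2 0 fun m n => YU v n (YU u m w)) =
  formalMul (deltaThree 1 2 1 0) (seriesIn 0 2 1 fun l n => YU (YV u l v) n w)

end FormalCalculus

/-! ## Vertex algebras and modules -/

/-- The components `vₙ` of `Y(v,x) = ∑ₙ vₙ x^{-n-1}`. The type `VertexOperator ℂ W` contains the
lower truncation condition: `vₙ w = 0` for `n` sufficiently large. -/
def modes {V W : Type*} [AddCommGroup V] [Module ℂ V] [AddCommGroup W] [Module ℂ W]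
    (Y : V →ₗ[ℂ] VertexOperator ℂ W) (v : V) (n : ℤ) : Module.End ℂ W :=
  VertexOperator.ncoeff (Y v) n

/-- Three operators `L(-1)`, `L(0)`, `L(1)` on a vector space. -/
structure Sl2Ops (U : Type*) [AddCommGroup U] [Module ℂ U] where
  Lneg : Module.End ℂ U
  Lzero : Module.End ℂ U
  Lone : Module.End ℂ U

/-- The operators `ω₀ = L(-1)`, `ω₁ = L(0)`, `ω₂ = L(1)`. -/
def sl2OfConformal {V W : Type*} [AddCommGroup V] [Module ℂ V] [AddCommGroup W] [Module ℂ W]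
    (Y : V →ₗ[ℂ] VertexOperator ℂ W) (ω : V) : Sl2Ops W where
  Lneg := modes Y ω 0
  Lzero := modes Y ω 1
  Lone := modes Y ω 2

/-- The `𝔰𝔩(2)` axioms for a vertex operator map `Y` of `V` on `W`: the bracket relations of
`𝔰𝔩(2)` on `W`, the brackets of `L(j)` with `Y(v,x)`,
`[L(-1), Y(v,x)] = Y(L(-1)v,x)`,
`[L(0), Y(v,x)] = Y(L(0)v,x) + x Y(L(-1)v,x)`,
`[L(1), Y(v,x)] = Y(L(1)v,x) + 2x Y(L(0)v,x) + x² Y(L(-1)v,x)`,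
and `d/dx Y(v,x) = Y(L(-1)v,x)`. -/
structure Sl2Axioms {V W : Type*} [AddCommGroup V] [Module ℂ V] [AddCommGroup W] [Module ℂ W]
    (Y : V →ₗ[ℂ] VertexOperator ℂ W) (LV : Sl2Ops V) (LW : Sl2Ops W) : Prop where
  zero_neg : ⁅LW.Lzero, LW.Lneg⁆ = LW.Lneg
  zero_one : ⁅LW.Lzero, LW.Lone⁆ = -LW.Lone
  neg_one : ⁅LW.Lneg, LW.Lone⁆ = (-2 : ℂ) • LW.Lzero
  neg_Y : ∀ v n, ⁅LW.Lneg, modes Y v n⁆ = modes Y (LV.Lneg v) n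
  zero_Y : ∀ v n, ⁅LW.Lzero, modes Y v n⁆ =
    modes Y (LV.Lzero v) n + modes Y (LV.Lneg v) (n + 1)
  one_Y : ∀ v n, ⁅LW.Lone, modes Y v n⁆ =
    modes Y (LV.Lone v) n + (2 : ℂ) • modes Y (LV.Lzero v) (n + 1) +
      modes Y (LV.Lneg v) (n + 2)
  deriv_Y : ∀ v n, modes Y (LV.Lneg v) n = (-(n : ℂ)) • modes Y v (n - 1)

/-- `L(n) = ω_{n+1}` satisfies the Virasoro relations with central charge `c`. -/
def Virasoro {V W : Type*} [AddCommGroup V] [Module ℂ V] [AddCommGroup W] [Module ℂ W]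
    (Y : V →ₗ[ℂ] VertexOperator ℂ W) (ω : V) (c : ℂ) : Prop :=
  ∀ m n : ℤ, ⁅modes Y ω (m + 1), modes Y ω (n + 1)⁆ =
    ((m : ℂ) - n) • modes Y ω (m + n + 1) +
      (if m + n = 0 then ((m : ℂ) ^ 3 - m) / 12 * c else 0) • (1 : Module.End ℂ W)

/-- What is common to strongly `A`-graded Möbius and conformal vertex algebras. The subspace
`gr n α` is `V_{(n)}^{(α)}`, of weight `n` and degree `α`. -/
structure VertexAlgebraCore (A V : Type*) [AddCommGroup A] [AddCommGroup V] [Module ℂ V] where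
  gr : ℤ → A → Submodule ℂ V
  gr_indep : iSupIndep fun p : ℤ × A => gr p.1 p.2
  gr_span : ⨆ p : ℤ × A, gr p.1 p.2 = ⊤
  gr_finite : ∀ n α, FiniteDimensional ℂ (gr n α)
  gr_lower : ∀ α, ∃ N : ℤ, ∀ n < N, gr n α = ⊥
  Y : V →ₗ[ℂ] VertexOperator ℂ V
  vac : V
  vac_mem : vac ∈ gr 0 0
  vac_Y : ∀ n, modes Y vac n = if n = -1 then 1 else 0
  creation : ∀ v, modes Y v (-1) vac = v ∧ ∀ n : ℤ, 0 ≤ n → modes Y v n vac = 0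
  jacobi : ∀ u v w, Jacobi (modes Y) (modes Y) u v w
  Y_degree : ∀ α β, ∀ u ∈ ⨆ n, gr n α, ∀ v ∈ ⨆ n, gr n β, ∀ l : ℤ,
    modes Y u l v ∈ ⨆ n, gr n (α + β)

/-- A strongly `A`-graded Möbius vertex algebra with underlying vector space `V`. -/
structure MobiusVertexAlgebra (A V : Type*) [AddCommGroup A] [AddCommGroup V] [Module ℂ V]
    extends VertexAlgebraCore A V where
  L : Sl2Ops V
  sl2 : Sl2Axioms Y L L
  weight : ∀ n α, ∀ v ∈ gr n α, L.Lzero v = (n : ℂ) • v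
  Lneg_degree : ∀ α, ∀ v ∈ ⨆ n, gr n α, L.Lneg v ∈ ⨆ n, gr n α
  Lzero_degree : ∀ α, ∀ v ∈ ⨆ n, gr n α, L.Lzero v ∈ ⨆ n, gr n α
  Lone_degree : ∀ α, ∀ v ∈ ⨆ n, gr n α, L.Lone v ∈ ⨆ n, gr n α

/-- A strongly `A`-graded conformal vertex algebra with underlying vector space `V`; its operators
are `L(n) = ω_{n+1}`. -/
structure ConformalVertexAlgebra (A V : Type*) [AddCommGroup A] [AddCommGroup V] [Module ℂ V]
    extends VertexAlgebraCore A V where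
  ω : V
  ω_mem : ω ∈ gr 2 0
  c : ℂ
  virasoro : Virasoro Y ω c
  deriv_Y : ∀ v n, modes Y (modes Y ω 0 v) n = (-(n : ℂ)) • modes Y v (n - 1)
  weight : ∀ n α, ∀ v ∈ gr n α, modes Y ω 1 v = (n : ℂ) • v

/-- What is common to strongly `Ã`-graded generalized modules for Möbius and for conformal vertex
algebras, where `A` is a subgroup of `Ã`. The subspace `gr n β` is `W_{[n]}^{(β)}`. -/
structure ModuleCore {G V : Type*} [AddCommGroup G] {A : AddSubgroup G} [AddCommGroup V]
    [Module ℂ V] (𝒱 : VertexAlgebraCore A V) (W : Type*) [AddCommGroup W] [Module ℂ W] where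
  gr : ℂ → G → Submodule ℂ W
  gr_indep : iSupIndep fun p : ℂ × G => gr p.1 p.2
  gr_span : ⨆ p : ℂ × G, gr p.1 p.2 = ⊤
  gr_finite : ∀ n β, FiniteDimensional ℂ (gr n β)
  gr_lower : ∀ (n : ℂ) (β : G), ∃ N : ℤ, ∀ k < N, gr (n + (k : ℂ)) β = ⊥
  Y : V →ₗ[ℂ] VertexOperator ℂ W
  vac_Y : ∀ n, modes Y 𝒱.vac n = if n = -1 then 1 else 0
  jacobi : ∀ u v w, Jacobi (modes 𝒱.Y) (modes Y) u v w
  Y_degree : ∀ (α : A) (β : G), ∀ u ∈ ⨆ n, 𝒱.gr n α, ∀ w ∈ ⨆ n, gr n β, ∀ l : ℤ,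
    modes Y u l w ∈ ⨆ n, gr n ((α : G) + β)

/-- A strongly graded generalized module for a Möbius vertex algebra: `W_{[n]}` consists of
generalized eigenvectors of `L(0)` with eigenvalue `n`. -/
structure MobiusModule {G V : Type*} [AddCommGroup G] {A : AddSubgroup G} [AddCommGroup V]
    [Module ℂ V] (𝒱 : MobiusVertexAlgebra A V) (W : Type*) [AddCommGroup W] [Module ℂ W]
    extends ModuleCore 𝒱.toVertexAlgebraCore W where
  L : Sl2Ops W
  sl2 : Sl2Axioms Y 𝒱.L L
  weight : ∀ n β, ∀ w ∈ gr n β, ∃ m : ℕ, ((L.Lzero - n • (1 : Module.End ℂ W)) ^ m) w = 0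
  Lneg_degree : ∀ β, ∀ w ∈ ⨆ n, gr n β, L.Lneg w ∈ ⨆ n, gr n β
  Lzero_degree : ∀ β, ∀ w ∈ ⨆ n, gr n β, L.Lzero w ∈ ⨆ n, gr n β
  Lone_degree : ∀ β, ∀ w ∈ ⨆ n, gr n β, L.Lone w ∈ ⨆ n, gr n β

/-- A strongly graded generalized module for a conformal vertex algebra. -/
structure ConformalModule {G V : Type*} [AddCommGroup G] {A : AddSubgroup G} [AddCommGroup V]
    [Module ℂ V] (𝒱 : ConformalVertexAlgebra A V) (W : Type*) [AddCommGroup W] [Module ℂ W]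
    extends ModuleCore 𝒱.toVertexAlgebraCore W where
  virasoro : Virasoro Y 𝒱.ω 𝒱.c
  deriv_Y : ∀ v n, modes Y (modes 𝒱.Y 𝒱.ω 0 v) n = (-(n : ℂ)) • modes Y v (n - 1)
  weight : ∀ n β, ∀ w ∈ gr n β,
    ∃ m : ℕ, ((modes Y 𝒱.ω 1 - n • (1 : Module.End ℂ W)) ^ m) w = 0

/-! ## Conformal vertex algebras and their modules as Möbius ones -/

section ConformalToMobius

variable {V W : Type*} [AddCommGroup V] [Module ℂ V] [AddCommGroup W] [Module ℂ W]

theorem modes_add (Y : V →ₗ[ℂ] VertexOperator ℂ W) (u v : V) (n : ℤ) :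
    modes Y (u + v) n = modes Y u n + modes Y v n := by
  simp [modes]

theorem modes_smul (Y : V →ₗ[ℂ] VertexOperator ℂ W) (a : ℂ) (v : V) (n : ℤ) :
    modes Y (a • v) n = a • modes Y v n := by
  simp [modes]

theorem modes_trunc (Y : V →ₗ[ℂ] VertexOperator ℂ W) (v : V) (w : W) :
    ∃ N : ℤ, ∀ n, N ≤ n → modes Y v n w = 0 := by
  refine ⟨-(HahnSeries.order ((HahnModule.of ℂ).symm (Y v w))), fun n hn => ?_⟩
  exact VertexOperator.ncoeff_eq_zero_of_lt_order _ _ _ (by omega)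

theorem deltaThree_support {ε : ℤˣ} {i j k : Fin 3} {e : Fin 3 → ℤ}
    (h : deltaThree ε i j k e ≠ 0) : 0 ≤ e k ∧ e j + e k = -e i - 1 ∧
      Ring.choose (-e i - 1) (e k).toNat ≠ 0 := by
  by_cases hc : 0 ≤ e k ∧ e j + e k = -e i - 1
  · refine ⟨hc.1, hc.2, fun h0 => h ?_⟩
    rw [deltaThree, if_pos hc, h0, Int.cast_zero, mul_zero]
  · exact absurd (if_neg hc) h

theorem seriesIn_support {W : Type*} [AddCommGroup W] {i j l : Fin 3} {F : ℤ → ℤ → W} {e : Fin 3 → ℤ}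
    (h : seriesIn i j l F e ≠ 0) : e l = 0 := by
  by_contra hc
  exact h (if_neg hc)

/-- The commutator formula `[u_m, v_n] = ∑_{i=0}^{m} (m choose i) (u_i v)_{m+n-i}` for `m ≥ 0`. -/
theorem commutator_of_jacobi (YV : V →ₗ[ℂ] VertexOperator ℂ V) (Y : V →ₗ[ℂ] VertexOperator ℂ W)
    (h : ∀ u v w, Jacobi (modes YV) (modes Y) u v w) (u v : V) (m : ℕ) (n : ℤ) :
    ⁅modes Y u m, modes Y v n⁆ =
      ∑ i ∈ Finset.range (m + 1), (m.choose i : ℂ) • modes Y (modes YV u i v) (m + n - i) := by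
  ext w
  have hJ := congrFun (h u v w).2.2.2 ![-1, -(m : ℤ) - 1, -n - 1]
  have h1 : formalMul (deltaThree 1 0 1 2)
      (seriesIn 1 2 0 fun a b => modes Y u a (modes Y v b w)) ![-1, -(m : ℤ) - 1, -n - 1] =
      modes Y u m (modes Y v n w) := by
    rw [formalMul, finsum_eq_single _ ![-1, 0, 0]]
    · simp [deltaThree, seriesIn]
    · intro p hp
      by_contra hne
      apply hp
      have hS := seriesIn_support (right_ne_zero_of_smul hne)
      obtain ⟨hk, hj, hz⟩ := deltaThree_support (left_ne_zero_of_smul hne)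
      have h0 : p 0 = -1 := by
        simp only [Pi.sub_apply, Matrix.cons_val_zero] at hS
        omega
      have h2 : p 2 = 0 := by
        by_contra hc
        exact hz (by rw [h0]; exact Ring.choose_zero_pos ℤ (k := (p 2).toNat) (by omega))
      funext i
      fin_cases i <;> simp <;> omega
  have h2 : formalMul (deltaThree (-1) 0 2 1)
      (seriesIn 1 2 0 fun a b => modes Y v b (modes Y u a w)) ![-1, -(m : ℤ) - 1, -n - 1] =
      modes Y v n (modes Y u m w) := by
    rw [formalMul, finsum_eq_single _ ![-1, 0, 0]]
    · simp [deltaThree, seriesIn]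
    · intro p hp
      by_contra hne
      apply hp
      have hS := seriesIn_support (right_ne_zero_of_smul hne)
      obtain ⟨hk, hj, hz⟩ := deltaThree_support (left_ne_zero_of_smul hne)
      have h0 : p 0 = -1 := by
        simp only [Pi.sub_apply, Matrix.cons_val_zero] at hS
        omega
      have h2 : p 1 = 0 := by
        by_contra hc
        exact hz (by rw [h0]; exact Ring.choose_zero_pos ℤ (k := (p 1).toNat) (by omega))
      funext i
      fin_cases i <;> simp <;> omega
  have hcoef : ∀ i : ℕ, (-1 : ℂ) ^ i * ((Ring.choose ((i : ℤ) - m - 1) i : ℤ) : ℂ) =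
      (m.choose i : ℂ) := by
    intro i
    have : Ring.choose ((i : ℤ) - m - 1) i = (-1) ^ i * (m.choose i : ℤ) := by
      have := Ring.choose_neg ((m : ℤ) + 1 - i) i
      rw [show -((m : ℤ) + 1 - i) = (i : ℤ) - m - 1 by ring,
        show (m : ℤ) + 1 - i + i - 1 = (m : ℤ) by ring] at this
      rw [this, ← Ring.choose_natCast (R := ℤ)]
      simp [Int.negOnePow, Units.smul_def]
    rw [this]
    push_cast
    rw [← mul_assoc, ← mul_pow]
    simp
  let f : ℕ ↪ (Fin 3 → ℤ) := ⟨fun i => ![i, -(m : ℤ) - 1, m - i], fun i j hij => by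
    have := congrFun hij 0
    simpa using this⟩
  have h3 : formalMul (deltaThree 1 2 1 0)
      (seriesIn 0 2 1 fun a b => modes Y (modes YV u a v) b w) ![-1, -(m : ℤ) - 1, -n - 1] =
      ∑ i ∈ Finset.range (m + 1), (m.choose i : ℂ) • modes Y (modes YV u i v) (m + n - i) w := by
    rw [formalMul, finsum_eq_finsetSum_of_support_subset (s := (Finset.range (m + 1)).map f)]
    · rw [Finset.sum_map]
      refine Finset.sum_congr rfl fun i _ => ?_
      have hfi : f i = ![(i : ℤ), -(m : ℤ) - 1, m - i] := rfl
      have e2 : (m : ℤ) - i - (-n - 1) - 1 = m + n - i := by ring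
      have e3 : -(m : ℤ) - 1 + i = i - m - 1 := by ring
      rw [hfi]
      simp [deltaThree, seriesIn, e2, e3, hcoef]
    · intro p hp
      rw [Function.mem_support] at hp
      have hS := seriesIn_support (right_ne_zero_of_smul hp)
      obtain ⟨hk, hj, hz⟩ := deltaThree_support (left_ne_zero_of_smul hp)
      have hp1 : p 1 = -(m : ℤ) - 1 := by
        simp only [Pi.sub_apply, Matrix.cons_val_one, Matrix.cons_val_zero] at hS
        omega
      obtain ⟨i, hi⟩ := Int.eq_ofNat_of_zero_le hk
      have him : i < m + 1 := by
        by_contra hc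
        have hzero := hcoef i
        rw [Nat.choose_eq_zero_of_lt (by omega)] at hzero
        rw [show -p 2 - 1 = (i : ℤ) - m - 1 by omega, hi, Int.toNat_natCast] at hz
        simp [hz] at hzero
      simp only [Finset.coe_map, Set.mem_image, Finset.mem_coe, Finset.mem_range]
      refine ⟨i, him, ?_⟩
      have hfi : f i = ![(i : ℤ), -(m : ℤ) - 1, m - i] := rfl
      rw [hfi]
      funext j
      fin_cases j <;> simp <;> omega
  rw [Pi.sub_apply, h1, h2, h3] at hJ
  simpa [LinearMap.sum_apply, Ring.lie_def] using hJ

/-- The `𝔰𝔩(2)` axioms follow from the conformal ones. -/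
theorem sl2Axioms_of_conformal (YV : V →ₗ[ℂ] VertexOperator ℂ V) (Y : V →ₗ[ℂ] VertexOperator ℂ W)
    (h : ∀ u v w, Jacobi (modes YV) (modes Y) u v w) (ω : V) (c : ℂ) (hω : Virasoro Y ω c)
    (hd : ∀ v n, modes Y (modes YV ω 0 v) n = (-(n : ℂ)) • modes Y v (n - 1)) :
    Sl2Axioms Y (sl2OfConformal YV ω) (sl2OfConformal Y ω) where
  zero_neg := by simpa [sl2OfConformal] using hω 0 (-1)
  zero_one := by simpa [sl2OfConformal] using hω 0 1
  neg_one := by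
    have := hω (-1) 1
    norm_num at this
    simpa [sl2OfConformal] using this
  neg_Y v n := by simpa [sl2OfConformal] using commutator_of_jacobi YV Y h ω v 0 n
  zero_Y v n := by
    have := commutator_of_jacobi YV Y h ω v 1 n
    simp only [Finset.sum_range_succ, Finset.sum_range_zero] at this
    simp only [sl2OfConformal]
    norm_num at this
    rw [this, add_comm, add_comm n 1]
  one_Y v n := by
    have := commutator_of_jacobi YV Y h ω v 2 n
    simp only [Finset.sum_range_succ, Finset.sum_range_zero] at this
    simp only [sl2OfConformal]
    norm_num at this
    rw [this, show (2 : ℤ) + n - 1 = n + 1 by ring, add_comm (2 : ℤ) n]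
    abel
  deriv_Y := hd

end ConformalToMobius

/-- A conformal vertex algebra is a Möbius vertex algebra with `L(j) = ω_{j+1}` for
`j = -1, 0, 1`. -/
def ConformalVertexAlgebra.toMobius {A V : Type*} [AddCommGroup A] [AddCommGroup V] [Module ℂ V]
    (𝒱 : ConformalVertexAlgebra A V) : MobiusVertexAlgebra A V where
  toVertexAlgebraCore := 𝒱.toVertexAlgebraCore
  L := sl2OfConformal 𝒱.Y 𝒱.ω
  sl2 := sl2Axioms_of_conformal 𝒱.Y 𝒱.Y 𝒱.jacobi 𝒱.ω 𝒱.c 𝒱.virasoro 𝒱.deriv_Y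
  weight := 𝒱.weight
  Lneg_degree α v hv := by
    simpa [sl2OfConformal] using
      𝒱.Y_degree 0 α 𝒱.ω (Submodule.mem_iSup_of_mem 2 𝒱.ω_mem) v hv 0
  Lzero_degree α v hv := by
    simpa [sl2OfConformal] using
      𝒱.Y_degree 0 α 𝒱.ω (Submodule.mem_iSup_of_mem 2 𝒱.ω_mem) v hv 1
  Lone_degree α v hv := by
    simpa [sl2OfConformal] using
      𝒱.Y_degree 0 α 𝒱.ω (Submodule.mem_iSup_of_mem 2 𝒱.ω_mem) v hv 2

/-- A generalized module for a conformal vertex algebra is one for the corresponding Möbius vertex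
algebra, with `L(j) = ω_{j+1}` for `j = -1, 0, 1`. -/
def ConformalModule.toMobius {G V : Type*} [AddCommGroup G] {A : AddSubgroup G} [AddCommGroup V]
    [Module ℂ V] {𝒱 : ConformalVertexAlgebra A V} {W : Type*} [AddCommGroup W] [Module ℂ W]
    (M : ConformalModule 𝒱 W) : MobiusModule 𝒱.toMobius W where
  toModuleCore := M.toModuleCore
  L := sl2OfConformal M.Y 𝒱.ω
  sl2 := sl2Axioms_of_conformal 𝒱.Y M.Y M.jacobi 𝒱.ω 𝒱.c M.virasoro M.deriv_Y
  weight := M.weight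
  Lneg_degree β w hw := by
    simpa [sl2OfConformal] using
      M.Y_degree 0 β 𝒱.ω (Submodule.mem_iSup_of_mem 2 𝒱.ω_mem) w hw 0
  Lzero_degree β w hw := by
    simpa [sl2OfConformal] using
      M.Y_degree 0 β 𝒱.ω (Submodule.mem_iSup_of_mem 2 𝒱.ω_mem) w hw 1
  Lone_degree β w hw := by
    simpa [sl2OfConformal] using
      M.Y_degree 0 β 𝒱.ω (Submodule.mem_iSup_of_mem 2 𝒱.ω_mem) w hw 2

/-! ## Expansions of rational functions and the actions `τ` -/

/-- The `ℂ`-algebra structure of `ℂ((t))`, singled out because another, propositionally equal,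
instance is found otherwise whose scalar multiplication does not unify with that of Hahn series. -/
instance (priority := 2000) laurentAlgebra : Algebra ℂ (LaurentSeries ℂ) :=
  HahnSeries.instAlgebra

/-- A Laurent series that is algebraic over `ℂ` is constant. -/
theorem transcendental_of_coeff_ne_zero (s : LaurentSeries ℂ) (n : ℤ) (hn : n ≠ 0)
    (hs : s.coeff n ≠ 0) : Transcendental ℂ s := by
  intro halg
  have hint : IsIntegral ℂ s := halg.isIntegral
  obtain ⟨c, hc⟩ := minpoly.mem_range_of_degree_eq_one ℂ s
    (IsAlgClosed.degree_eq_one_of_irreducible ℂ (minpoly.irreducible hint))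
  apply hs
  rw [← hc, show algebraMap ℂ (LaurentSeries ℂ) c = HahnSeries.C c from rfl]
  simp [HahnSeries.C_apply, HahnSeries.coeff_single_of_ne hn]

/-- `f(t) ↦ f(s)`: substitution of a transcendental Laurent series `s` into a rational function. -/
def substRat (s : LaurentSeries ℂ) (hs : Transcendental ℂ s) : RatFunc ℂ →ₐ[ℂ] LaurentSeries ℂ :=
  RatFunc.liftAlgHom (Polynomial.aeval s)
    (nonZeroDivisors_le_comap_nonZeroDivisors_of_injective _
      (transcendental_iff_injective.mp hs))

/-- `f(t) ↦ f(t - z)`, expanded as a Laurent series in `t`. -/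
def expandPlus (z : ℂ) : RatFunc ℂ →ₐ[ℂ] LaurentSeries ℂ :=
  substRat (HahnSeries.single 1 1 - HahnSeries.C z)
    (transcendental_of_coeff_ne_zero _ 1 one_ne_zero (by
      simp [HahnSeries.C_apply]))

/-- `f(t) ↦ f(t - z)`, expanded as a Laurent series in `t⁻¹`. An element of `ℂ((t⁻¹))` is
represented as a Laurent series in the variable `s = t⁻¹`, so `t` becomes `s⁻¹`. -/
def expandMinus (z : ℂ) : RatFunc ℂ →ₐ[ℂ] LaurentSeries ℂ :=
  substRat (HahnSeries.single (-1) 1 - HahnSeries.C z)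
    (transcendental_of_coeff_ne_zero _ (-1) (by norm_num) (by
      simp [HahnSeries.C_apply]))

/-- The algebra `ℂ[t, t⁻¹, (z + t)⁻¹]` of rational functions; the expansion `ι₊` in powers of `t`
is injective on it and identifies it with `ι₊ ℂ[t, t⁻¹, (z + t)⁻¹] ⊆ ℂ((t))`. -/
def locAlg (z : ℂ) : Subalgebra ℂ (RatFunc ℂ) :=
  Algebra.adjoin ℂ {RatFunc.X, RatFunc.X⁻¹, (RatFunc.C z + RatFunc.X)⁻¹}

theorem locAlg_mem (z : ℂ) (m n : ℤ) :
    (RatFunc.C z + RatFunc.X) ^ m * RatFunc.X ^ n ∈ locAlg z := by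
  have hX : RatFunc.X ∈ locAlg z := Algebra.subset_adjoin (by simp)
  have hX' : RatFunc.X⁻¹ ∈ locAlg z := Algebra.subset_adjoin (by simp)
  have hZ' : (RatFunc.C z + RatFunc.X)⁻¹ ∈ locAlg z := Algebra.subset_adjoin (by simp)
  have hZ : RatFunc.C z + RatFunc.X ∈ locAlg z :=
    add_mem (by rw [← RatFunc.algebraMap_eq_C]; exact (locAlg z).algebraMap_mem z) hX
  have key : ∀ a : RatFunc ℂ, a ∈ locAlg z → a⁻¹ ∈ locAlg z → ∀ k : ℤ, a ^ k ∈ locAlg z := by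
    intro a ha ha' k
    obtain ⟨j, rfl | rfl⟩ := k.eq_nat_or_neg
    · simpa using pow_mem ha j
    · simpa using pow_mem ha' j
  exact mul_mem (key _ hZ hZ' m) (key _ hX hX' n)

/-- The element `(z + t)^m t^n` of `ℂ[t, t⁻¹, (z + t)⁻¹]`. -/
def locElem (z : ℂ) (m n : ℤ) : locAlg z :=
  ⟨(RatFunc.C z + RatFunc.X) ^ m * RatFunc.X ^ n, locAlg_mem z m n⟩

section TauW

variable {V W : Type*} [AddCommGroup V] [Module ℂ V] [AddCommGroup W] [Module ℂ W]

theorem tauW_finite (Y : V →ₗ[ℂ] VertexOperator ℂ W) (v : V) (f : LaurentSeries ℂ) (w : W) :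
    (Function.support fun n : ℤ => f.coeff n • modes Y v n w).Finite := by
  obtain ⟨N, hN⟩ := modes_trunc Y v w
  refine (Set.finite_Icc f.order N).subset fun n hn => ?_
  rw [Function.mem_support] at hn
  refine ⟨?_, ?_⟩
  · by_contra hc
    exact hn (by rw [HahnSeries.coeff_eq_zero_of_lt_order (not_le.mp hc), zero_smul])
  · by_contra hc
    exact hn (by rw [hN n (by omega), smul_zero])

/-- The action `τ_W` of `V ⊗ ℂ((t))` on `W`: `v ⊗ ∑ₙ aₙ tⁿ` acts as `∑ₙ aₙ vₙ`. -/
def tauW (Y : V →ₗ[ℂ] VertexOperator ℂ W) : V ⊗[ℂ] LaurentSeries ℂ →ₗ[ℂ] Module.End ℂ W :=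
  TensorProduct.lift <| LinearMap.mk₂ ℂ
    (fun v f =>
      { toFun := fun w => ∑ᶠ n : ℤ, f.coeff n • modes Y v n w
        map_add' := fun w w' => by
          rw [← finsum_add_distrib (tauW_finite Y v f w) (tauW_finite Y v f w')]
          simp
        map_smul' := fun a w => by
          rw [RingHom.id_apply, smul_finsum' a (tauW_finite Y v f w)]
          simp only [map_smul, smul_comm a] })
    (fun v v' f => by
      ext w
      simp only [LinearMap.coe_mk, AddHom.coe_mk, LinearMap.add_apply]
      rw [← finsum_add_distrib (tauW_finite Y v f w) (tauW_finite Y v' f w)]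
      simp [modes_add])
    (fun a v f => by
      ext w
      simp only [LinearMap.coe_mk, AddHom.coe_mk, LinearMap.smul_apply]
      rw [smul_finsum' a (tauW_finite Y v f w)]
      simp only [modes_smul, LinearMap.smul_apply, smul_comm a])
    (fun v f f' => by
      ext w
      simp only [LinearMap.coe_mk, AddHom.coe_mk, LinearMap.add_apply]
      rw [← finsum_add_distrib (tauW_finite Y v f w) (tauW_finite Y v f' w)]
      simp [add_smul])
    (fun a v f => by
      ext w
      simp only [LinearMap.coe_mk, AddHom.coe_mk, LinearMap.smul_apply]
      rw [smul_finsum' a (tauW_finite Y v f w)]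
      simp [mul_smul])

end TauW

/-! ## The opposite-operator map -/

section Opposite

variable {A V : Type*} [AddCommGroup A] [AddCommGroup V] [Module ℂ V]

/-- `L(1)` maps `V_{(n)}^{(α)}` into `V_{(n-1)}^{(α)}`. -/
theorem Lone_mem (𝒱 : MobiusVertexAlgebra A V) (n : ℤ) (α : A) (v : V) (hv : v ∈ 𝒱.gr n α) :
    𝒱.L.Lone v ∈ 𝒱.gr (n - 1) α := by
  set x := 𝒱.L.Lone v with hx
  have hdeg : x ∈ ⨆ k, 𝒱.gr k α := 𝒱.Lone_degree α v (Submodule.mem_iSup_of_mem n hv)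
  have hE : ∀ k, ∀ y ∈ 𝒱.gr k α, y ∈ Module.End.eigenspace 𝒱.L.Lzero (k : ℂ) := fun k y hy =>
    Module.End.mem_eigenspace_iff.mpr (𝒱.weight k α y hy)
  have hxE : x ∈ Module.End.eigenspace 𝒱.L.Lzero ((n - 1 : ℤ) : ℂ) := by
    rw [Module.End.mem_eigenspace_iff]
    have h := LinearMap.congr_fun 𝒱.sl2.zero_one v
    rw [Ring.lie_def] at h
    simp only [LinearMap.sub_apply, Module.End.mul_apply, LinearMap.neg_apply] at h
    rw [𝒱.weight n α v hv, map_smul, sub_eq_iff_eq_add] at h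
    rw [hx, h]
    push_cast
    module
  have hsplit : ⨆ k, 𝒱.gr k α ≤ 𝒱.gr (n - 1) α ⊔
      ⨆ (μ : ℂ) (_ : μ ≠ ((n - 1 : ℤ) : ℂ)), Module.End.eigenspace 𝒱.L.Lzero μ := by
    refine iSup_le fun k => ?_
    by_cases hk : k = n - 1
    · rw [hk]
      exact le_sup_left
    · refine le_trans (fun y hy => ?_) le_sup_right
      exact Submodule.mem_iSup_of_mem (k : ℂ)
        (Submodule.mem_iSup_of_mem (by exact_mod_cast hk) (hE k y hy))
  obtain ⟨a, ha, b, hb, hab⟩ := Submodule.mem_sup.mp (hsplit hdeg)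
  have hbE : b ∈ Module.End.eigenspace 𝒱.L.Lzero ((n - 1 : ℤ) : ℂ) := by
    rw [show b = x - a by rw [← hab]; abel]
    exact sub_mem hxE (hE _ a ha)
  have hb0 : b = 0 := Submodule.disjoint_def.mp
    (Module.End.eigenspaces_iSupIndep 𝒱.L.Lzero ((n - 1 : ℤ) : ℂ)) b hbE hb
  rw [← hab, hb0, add_zero]
  exact ha

/-- `L(1)` acts locally nilpotently on `V`. -/
theorem Lone_nilpotent (𝒱 : MobiusVertexAlgebra A V) (v : V) :
    ∃ M : ℕ, ∀ m, M ≤ m → (𝒱.L.Lone ^ m) v = 0 := by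
  have h1 : ∀ (m : ℕ) n α, ∀ v ∈ 𝒱.gr n α, (𝒱.L.Lone ^ m) v ∈ 𝒱.gr (n - m) α := by
    intro m n α v hv
    induction m with
    | zero => simpa using hv
    | succ m ih =>
      rw [pow_succ', Module.End.mul_apply]
      have := Lone_mem 𝒱 _ _ _ ih
      rwa [show n - ((m + 1 : ℕ) : ℤ) = n - m - 1 by push_cast; ring]
  have hv : v ∈ ⨆ p : ℤ × A, 𝒱.gr p.1 p.2 := by rw [𝒱.gr_span]; trivial
  refine Submodule.iSup_induction _
    (motive := fun v => ∃ M : ℕ, ∀ m, M ≤ m → (𝒱.L.Lone ^ m) v = 0) hv ?_ ?_ ?_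
  · rintro ⟨n, α⟩ x hx
    obtain ⟨N, hN⟩ := 𝒱.gr_lower α
    refine ⟨(n - N + 1).toNat, fun m hm => ?_⟩
    have := h1 m n α x hx
    rwa [hN _ (by omega), Submodule.mem_bot] at this
  · exact ⟨0, fun m _ => map_zero _⟩
  · rintro x y ⟨M, hM⟩ ⟨M', hM'⟩
    refine ⟨max M M', fun m hm => ?_⟩
    rw [map_add, hM m (le_trans (le_max_left _ _) hm), hM' m (le_trans (le_max_right _ _) hm),
      add_zero]

theorem oppWeight_finite (𝒱 : MobiusVertexAlgebra A V) (h : ℤ) (v : V) :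
    (Function.support fun m : ℕ => ((m.factorial : ℂ)⁻¹ • (𝒱.L.Lone ^ m) v) ⊗ₜ[ℂ]
      (HahnSeries.single (2 * h - 2 - m) 1 : LaurentSeries ℂ)).Finite := by
  obtain ⟨M, hM⟩ := Lone_nilpotent 𝒱 v
  refine (Set.finite_Iio M).subset fun m hm => ?_
  by_contra hc
  rw [Set.mem_Iio, not_lt] at hc
  exact hm (by simp [hM m hc])

/-- `v ↦ (-1)^h ∑ₘ (1/m!) L(1)^m v ⊗ t^{2h-2-m}`. -/
def oppWeight (𝒱 : MobiusVertexAlgebra A V) (h : ℤ) : V →ₗ[ℂ] V ⊗[ℂ] LaurentSeries ℂ where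
  toFun v := (-1 : ℂ) ^ h • ∑ᶠ m : ℕ, ((m.factorial : ℂ)⁻¹ • (𝒱.L.Lone ^ m) v) ⊗ₜ[ℂ]
    (HahnSeries.single (2 * h - 2 - m) 1 : LaurentSeries ℂ)
  map_add' v v' := by
    rw [← smul_add, ← finsum_add_distrib (oppWeight_finite 𝒱 h v) (oppWeight_finite 𝒱 h v')]
    simp [TensorProduct.add_tmul]
  map_smul' a v := by
    rw [RingHom.id_apply, smul_comm a, smul_finsum' a (oppWeight_finite 𝒱 h v)]
    congr 1
    refine finsum_congr fun m => ?_
    rw [map_smul, smul_comm, TensorProduct.smul_tmul']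

open Classical in
theorem gr_bijective (𝒱 : VertexAlgebraCore A V) :
    Function.Bijective (DirectSum.coeLinearMap fun p : ℤ × A => 𝒱.gr p.1 p.2) :=
  DirectSum.isInternal_submodule_of_iSupIndep_of_iSup_eq_top 𝒱.gr_indep 𝒱.gr_span

open Classical in
/-- `v ↦ v^o`, where `v^o = (-1)^h ∑ₘ (1/m!) L(1)^m v ⊗ t^{-m-2+2h}` for `v` of weight `h`. -/
def opp (𝒱 : MobiusVertexAlgebra A V) : V →ₗ[ℂ] V ⊗[ℂ] LaurentSeries ℂ :=
  DirectSum.toModule ℂ (ℤ × A) _ (fun p => oppWeight 𝒱 p.1 ∘ₗ (𝒱.gr p.1 p.2).subtype) ∘ₗ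
    (LinearEquiv.ofBijective
      (DirectSum.coeLinearMap fun p : ℤ × A => 𝒱.gr p.1 p.2) (gr_bijective _)).symm.toLinearMap

/-- The map `o : V ⊗ ℂ((t⁻¹)) → V ⊗ ℂ((t))`, `v ⊗ f(t) ↦ v^o f(t⁻¹)`. As an element `f(t)` of
`ℂ((t⁻¹))` is represented as a Laurent series in `s = t⁻¹`, the series `f(t⁻¹)` has the same
coefficients as this representative. -/
def oppMap (𝒱 : MobiusVertexAlgebra A V) :
    V ⊗[ℂ] LaurentSeries ℂ →ₗ[ℂ] V ⊗[ℂ] LaurentSeries ℂ :=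
  TensorProduct.lift
    ((LinearMap.lTensorHom V ∘ₗ (Algebra.lmul ℂ (LaurentSeries ℂ)).toLinearMap).flip ∘ₗ opp 𝒱)

end Opposite

/-! ## The action `τ_{Q(z)}` and the compatibility condition -/

section Qz

variable {G V : Type*} [AddCommGroup G] {A : AddSubgroup G} [AddCommGroup V] [Module ℂ V]

/-- `T⁺_{-z} : V ⊗ ℂ[t, t⁻¹, (z+t)⁻¹] → V ⊗ ℂ((t))`. -/
def TPlus (V : Type*) [AddCommGroup V] [Module ℂ V] (z : ℂ) :
    V ⊗[ℂ] locAlg z →ₗ[ℂ] V ⊗[ℂ] LaurentSeries ℂ :=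
  LinearMap.lTensor V ((expandPlus z).comp (locAlg z).val).toLinearMap

/-- `T⁻_{-z} : V ⊗ ℂ[t, t⁻¹, (z+t)⁻¹] → V ⊗ ℂ((t⁻¹))`. -/
def TMinus (V : Type*) [AddCommGroup V] [Module ℂ V] (z : ℂ) :
    V ⊗[ℂ] locAlg z →ₗ[ℂ] V ⊗[ℂ] LaurentSeries ℂ :=
  LinearMap.lTensor V ((expandMinus z).comp (locAlg z).val).toLinearMap

/-- `T^o_{-z} = o ∘ T⁻_{-z}`. -/
def TOpp {A V : Type*} [AddCommGroup A] [AddCommGroup V] [Module ℂ V]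
    (𝒱 : MobiusVertexAlgebra A V) (z : ℂ) : V ⊗[ℂ] locAlg z →ₗ[ℂ] V ⊗[ℂ] LaurentSeries ℂ :=
  oppMap 𝒱 ∘ₗ TMinus V z

variable {𝒱 : MobiusVertexAlgebra A V} {W₁ W₂ : Type*} [AddCommGroup W₁] [Module ℂ W₁]
  [AddCommGroup W₂] [Module ℂ W₂]

/-- The action `τ_{Q(z)}` of `V ⊗ ℂ[t, t⁻¹, (z+t)⁻¹]` on `(W₁ ⊗ W₂)*`:
`(τ_{Q(z)}(ξ)λ)(w₁ ⊗ w₂) = λ(τ_{W₁}(T^o_{-z} ξ) w₁ ⊗ w₂) - λ(w₁ ⊗ τ_{W₂}(T⁺_{-z} ξ) w₂)`. -/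
def tauQ (z : ℂ) (M₁ : MobiusModule 𝒱 W₁) (M₂ : MobiusModule 𝒱 W₂) :
    V ⊗[ℂ] locAlg z →ₗ[ℂ] Module.End ℂ (Module.Dual ℂ (W₁ ⊗[ℂ] W₂)) :=
  Module.Dual.transpose ∘ₗ
    (LinearMap.rTensorHom W₂ ∘ₗ tauW M₁.Y ∘ₗ TOpp 𝒱 z -
      LinearMap.lTensorHom W₁ ∘ₗ tauW M₂.Y ∘ₗ TPlus V z)

/-- The components of `Y'_{Q(z)}(v,x) = ∑ₙ τ_{Q(z)}(v ⊗ tⁿ) x^{-n-1}`. -/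
def YQ (z : ℂ) (M₁ : MobiusModule 𝒱 W₁) (M₂ : MobiusModule 𝒱 W₂) (v : V) (n : ℤ) :
    Module.End ℂ (Module.Dual ℂ (W₁ ⊗[ℂ] W₂)) :=
  tauQ z M₁ M₂ (v ⊗ₜ locElem z 0 n)

/-- The series `z⁻¹ δ((x₁ - x₀)/z) Y_t(v,x₀) = v ⊗ (∑ₘ (z + t)^m x₁^{-m-1}) (∑ₙ tⁿ x₀^{-n-1})`
in `x₀, x₁` with coefficients in `V ⊗ ℂ[t, t⁻¹, (z+t)⁻¹]`. -/
def deltaYt (z : ℂ) (v : V) : FormalSeries 2 (V ⊗[ℂ] locAlg z) :=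
  fun e => v ⊗ₜ locElem z (-e 1 - 1) (-e 0 - 1)

/-- The `Q(z)`-compatibility condition on `lam ∈ (W₁ ⊗ W₂)*`. -/
structure QzCompatible (z : ℂ) (M₁ : MobiusModule 𝒱 W₁) (M₂ : MobiusModule 𝒱 W₂)
    (lam : Module.Dual ℂ (W₁ ⊗[ℂ] W₂)) : Prop where
  /-- The `Q(z)`-lower truncation condition: `Y'_{Q(z)}(v,x) lam` involves only finitely many
  negative powers of `x`. -/
  lower_truncation : ∀ v : V, ∃ N : ℤ, ∀ n, N ≤ n → YQ z M₁ M₂ v n lam = 0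
  /-- `τ_{Q(z)}(z⁻¹ δ((x₁ - x₀)/z) Y_t(v,x₀)) lam = z⁻¹ δ((x₁ - x₀)/z) Y'_{Q(z)}(v,x₀) lam`. -/
  compatibility : ∀ v : V, (fun e => tauQ z M₁ M₂ (deltaYt z v e) lam) =
    formalMul (deltaTwo z) fun e => if e 1 = 0 then YQ z M₁ M₂ v (-e 0 - 1) lam else 0

end Qz

end QzTensor

end

noncomputable section

namespace QzTensor

/-! ## Eventually constant partial sums -/

section EventualSum

/-! The Jacobi identity is equivalent to its components, the Borcherds identities indexed by `p`,
`m`, `n` (`jacobi_iff`). Each of them is a sum over `k ≥ 0` whose partial sums are eventually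
constant. `EventualSum` records this, so that such identities can be added, mapped and compared
before a common cutoff is known.

Put y = z + t. On a pure tensor, a mode of Y'_{Q(z)} is a difference of an operator on W₁, expanded
in powers of y⁻¹, and an operator on W₂, expanded in powers of y. A product of two modes therefore
has four parts, and t₁ - t₂ = y₁ - y₂. Formally, the parts with both factors on W₁ give the
Borcherds identity for opposite vertex operators on W₁, the parts with both factors on W₂ give the
one for W₂, and the mixed parts cancel in the commutator.

The obstacle is one of expansion: the product of modes calls for (t₁ - t₂)^p expanded in powers of
t₂, whereas the identities on W₁ and W₂ use expansions of (y₁ - y₂)^p in y₁ and y₂. Compatibility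
removes it. It implies that v ⊗ (z + t)^m tⁿ annihilates λ for all large n, uniformly in m
(`QzCompatible.exists_tauQ_eq_zero`). With this, `eventualSum_expansion` changes one expansion into
the other, by induction on p in both directions.

Two further ingredients supply the identities on W₁ and W₂. First, the iterate term C(a,k) y^(a+b-k)
equals (1/k!) (d/dy)^k(y^a) · y^b, so a Borcherds identity is bilinear in two test series. By
uniform continuity it passes from monomials to powers of y - z (`ContinuousAction.borcherds`,
`ContinuousAction.borcherds_opposite`). Second, the identity for opposite operators
(`borcherds_opposite`) reduces to the ordinary ones for the vectors L(1)^i u / i! and L(1)^j v / j!,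
together with a formula for divided powers of L(1) on u_q v (`tripleSum_modes_dividedPower`). -/

/-- All but finitely many partial sums of `c` are equal to `s`. -/
def EventualSum {M : Type*} [AddCommGroup M] (c : ℕ → M) (s : M) : Prop :=
  ∃ K₀, ∀ K, K₀ ≤ K → ∑ k ∈ Finset.range K, c k = s

variable {M N : Type*} [AddCommGroup M] [AddCommGroup N] {c d : ℕ → M} {s t : M}

theorem EventualSum.unique (h : EventualSum c s) (h' : EventualSum c t) : s = t := by
  obtain ⟨K, hK⟩ := h
  obtain ⟨K', hK'⟩ := h'
  rw [← hK (max K K') (le_max_left _ _), hK' _ (le_max_right _ _)]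

theorem EventualSum.of_forall_ge {K₀ : ℕ} (h : ∀ k, K₀ ≤ k → c k = 0) :
    EventualSum c (∑ k ∈ Finset.range K₀, c k) := by
  refine ⟨K₀, fun K hK => (Finset.sum_subset ?_ ?_).symm⟩
  · simpa using hK
  · intro k _ hk
    exact h k (by simpa using hk)

theorem EventualSum.of_forall_eq_zero (h : ∀ k, c k = 0) : EventualSum c 0 :=
  ⟨0, fun _ _ => Finset.sum_eq_zero fun k _ => h k⟩

theorem EventualSum.add (h : EventualSum c s) (h' : EventualSum d t) :
    EventualSum (fun k => c k + d k) (s + t) := by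
  obtain ⟨K, hK⟩ := h
  obtain ⟨K', hK'⟩ := h'
  refine ⟨max K K', fun k hk => ?_⟩
  rw [Finset.sum_add_distrib, hK _ (le_trans (le_max_left _ _) hk),
    hK' _ (le_trans (le_max_right _ _) hk)]

theorem EventualSum.map (f : M →+ N) (h : EventualSum c s) :
    EventualSum (fun k => f (c k)) (f s) := by
  obtain ⟨K, hK⟩ := h
  exact ⟨K, fun k hk => by rw [← map_sum, hK k hk]⟩

theorem EventualSum.neg (h : EventualSum c s) : EventualSum (fun k => -c k) (-s) :=
  h.map (negAddMonoidHom : M →+ M)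

theorem EventualSum.sub (h : EventualSum c s) (h' : EventualSum d t) :
    EventualSum (fun k => c k - d k) (s - t) := by
  simpa only [sub_eq_add_neg] using h.add h'.neg

theorem EventualSum.const_smul [Module ℂ M] (a : ℂ) (h : EventualSum c s) :
    EventualSum (fun k => a • c k) (a • s) :=
  h.map (DistribSMul.toAddMonoidHom M a)

theorem EventualSum.congr (h : EventualSum c s) (hcd : ∀ k, c k = d k) : EventualSum d s := by
  rwa [← funext hcd]

theorem EventualSum.sum {ι : Type*} {F : Finset ι} {c : ι → ℕ → M} {s : ι → M}
    (h : ∀ i ∈ F, EventualSum (c i) (s i)) :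
    EventualSum (fun k => ∑ i ∈ F, c i k) (∑ i ∈ F, s i) := by
  classical
  induction F using Finset.induction_on with
  | empty => exact .of_forall_eq_zero fun k => by simp
  | insert a F ha ih =>
    simp only [Finset.sum_insert ha]
    exact (h a (Finset.mem_insert_self _ _)).add
      (ih fun i hi => h i (Finset.mem_insert_of_mem hi))

theorem EventualSum.single (h : ∀ k, c (k + 1) = 0) : EventualSum c (c 0) := by
  refine ⟨1, fun K hK => ?_⟩
  obtain ⟨K, rfl⟩ := Nat.exists_eq_add_of_le' hK
  rw [Finset.sum_range_succ', Finset.sum_eq_zero fun k _ => h k, zero_add]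

/-- A finitely supported sum over a type, all of whose nonzero terms lie in a sequence. -/
theorem finsum_eventualSum {α : Type*} {f : α → M} {φ : ℕ → α} (hφ : Function.Injective φ)
    (hf : ∀ a, f a ≠ 0 → ∃ k, φ k = a) {K₀ : ℕ} (h : ∀ k, K₀ ≤ k → f (φ k) = 0) :
    (Function.support f).Finite ∧ EventualSum (fun k => f (φ k)) (∑ᶠ a, f a) := by
  have hsub : Function.support f ⊆ ((Finset.range K₀).map ⟨φ, hφ⟩ : Finset α) := by
    intro a ha
    obtain ⟨k, rfl⟩ := hf a ha
    have : k < K₀ := by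
      by_contra hc
      exact ha (h k (not_lt.mp hc))
    simpa using ⟨k, this, rfl⟩
  refine ⟨(Finset.finite_toSet _).subset hsub, ?_⟩
  rw [finsum_eq_finsetSum_of_support_subset _ hsub, Finset.sum_map]
  exact .of_forall_ge h

end EventualSum

/-! ## The Jacobi identity in components -/

/-- The binomial coefficient `(n choose k)` for an integer `n`. -/
def binom (n : ℤ) (k : ℕ) : ℂ := ((Ring.choose n k : ℤ) : ℂ)

/-- The coefficient `(-1)^k (n choose k)` of `x^{n-k} y^k` in `(x - y)^n`. -/
def altBinom (n : ℤ) (k : ℕ) : ℂ := (-1) ^ k * binom n k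

theorem binom_zero_right (n : ℤ) : binom n 0 = 1 := by simp [binom]

theorem binom_zero_succ (k : ℕ) : binom 0 (k + 1) = 0 := by simp [binom]

theorem binom_succ_succ (n : ℤ) (k : ℕ) : binom (n + 1) (k + 1) = binom n k + binom n (k + 1) := by
  rw [binom, Ring.choose_succ_succ]
  simp [binom]

theorem altBinom_succ_succ (n : ℤ) (k : ℕ) :
    altBinom (n + 1) (k + 1) = altBinom n (k + 1) - altBinom n k := by
  rw [altBinom, binom_succ_succ, altBinom, altBinom]
  ring

/-- Upper negation of binomial coefficients. -/
theorem altBinom_eq (n : ℤ) (k : ℕ) : altBinom n k = binom (k - n - 1) k := by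
  have h := Ring.choose_neg (n + 1 - k) k
  rw [show -(n + 1 - k) = (k : ℤ) - n - 1 by ring, show n + 1 - k + k - 1 = n by ring] at h
  rw [altBinom, binom, binom, h]
  simp [Int.negOnePow, Units.smul_def]

theorem binom_eq (n : ℤ) (k : ℕ) : binom n k = altBinom (k - n - 1) k := by
  rw [altBinom_eq]
  congr 1
  ring

section Borcherds

variable {U V : Type*} [AddCommGroup U] [Module ℂ U] [AddCommGroup V] [Module ℂ V]

/-- The `k`-th term of the Borcherds identity for `u, v` acting on `w`. -/
def borcherdsTerm (YV : V → ℤ → Module.End ℂ V) (YU : V → ℤ → Module.End ℂ U) (u v : V) (w : U)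
    (p m n : ℤ) (k : ℕ) : U :=
  altBinom p k • YU u (m + p - k) (YU v (n + k) w) -
    ((-1) ^ p * altBinom p k) • YU v (n + p - k) (YU u (m + k) w) -
    binom m k • YU (YV u (p + k) v) (m + n - k) w

/-- The integers `p`, `m`, `n` label the coefficient of x₀^(-p-1) x₁^(-m-1) x₂^(-n-1). The supports
of the delta function and of the series leave a single free exponent `k ≥ 0`, and `h` truncates it.
The next two lemmas treat the other two delta functions in the same way. -/
theorem deltaThree_one_012 (F : ℤ → ℤ → U) (p m n : ℤ) {K₀ : ℕ}
    (h : ∀ k : ℕ, K₀ ≤ k → F (m + p - k) (n + k) = 0) :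
    {q | deltaThree 1 0 1 2 q • seriesIn 1 2 0 F (![-p - 1, -m - 1, -n - 1] - q) ≠ 0}.Finite ∧
    EventualSum (fun k => altBinom p k • F (m + p - k) (n + k))
      (formalMul (deltaThree 1 0 1 2) (seriesIn 1 2 0 F) ![-p - 1, -m - 1, -n - 1]) := by
  have hterm : ∀ k : ℕ, deltaThree 1 0 1 2 ![-p - 1, p - k, k] •
      seriesIn 1 2 0 F (![-p - 1, -m - 1, -n - 1] - ![-p - 1, p - k, k]) =
      altBinom p k • F (m + p - k) (n + k) := fun k => by
    have e1 : p - (k : ℤ) - (-m - 1) - 1 = m + p - k := by ring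
    have e2 : (k : ℤ) - (-n - 1) - 1 = n + k := by ring
    simp [deltaThree, seriesIn, altBinom, binom, e1, e2]
  have := finsum_eventualSum (φ := fun k : ℕ => (![-p - 1, p - k, k] : Fin 3 → ℤ))
    (f := fun q => deltaThree 1 0 1 2 q • seriesIn 1 2 0 F (![-p - 1, -m - 1, -n - 1] - q))
    (fun i j hij => by simpa using congrFun hij 2) (fun q hq => ?_) (K₀ := K₀)
    (fun k hk => by rw [hterm, h k hk, smul_zero])
  · simp only [hterm] at this
    exact this
  · have hS := seriesIn_support (right_ne_zero_of_smul hq)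
    obtain ⟨hk, hj, -⟩ := deltaThree_support (left_ne_zero_of_smul hq)
    simp only [Pi.sub_apply, Matrix.cons_val_zero] at hS
    refine ⟨(q 2).toNat, ?_⟩
    funext j
    fin_cases j <;> simp <;> omega

theorem deltaThree_neg_021 (F : ℤ → ℤ → U) (p m n : ℤ) {K₀ : ℕ}
    (h : ∀ k : ℕ, K₀ ≤ k → F (m + k) (n + p - k) = 0) :
    {q | deltaThree (-1) 0 2 1 q • seriesIn 1 2 0 F (![-p - 1, -m - 1, -n - 1] - q) ≠ 0}.Finite ∧
    EventualSum (fun k => ((-1) ^ p * altBinom p k) • F (m + k) (n + p - k))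
      (formalMul (deltaThree (-1) 0 2 1) (seriesIn 1 2 0 F) ![-p - 1, -m - 1, -n - 1]) := by
  have hterm : ∀ k : ℕ, deltaThree (-1) 0 2 1 ![-p - 1, k, p - k] •
      seriesIn 1 2 0 F (![-p - 1, -m - 1, -n - 1] - ![-p - 1, k, p - k]) =
      ((-1) ^ p * altBinom p k) • F (m + k) (n + p - k) := fun k => by
    have e1 : p - (k : ℤ) - (-n - 1) - 1 = n + p - k := by ring
    have e2 : (k : ℤ) - (-m - 1) - 1 = m + k := by ring
    have e3 : (((((-1 : ℤˣ) ^ p : ℤˣ) : ℤ) : ℂ)) = (-1) ^ p := by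
      rcases Int.even_or_odd p with hp | hp
      · simp [hp.neg_one_zpow]
      · simp [hp.neg_one_zpow]
    simp [deltaThree, seriesIn, altBinom, binom, e1, e2, e3, mul_assoc]
  have := finsum_eventualSum (φ := fun k : ℕ => (![-p - 1, k, p - k] : Fin 3 → ℤ))
    (f := fun q => deltaThree (-1) 0 2 1 q • seriesIn 1 2 0 F (![-p - 1, -m - 1, -n - 1] - q))
    (fun i j hij => by simpa using congrFun hij 1) (fun q hq => ?_) (K₀ := K₀)
    (fun k hk => by rw [hterm, h k hk, smul_zero])
  · simp only [hterm] at this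
    exact this
  · have hS := seriesIn_support (right_ne_zero_of_smul hq)
    obtain ⟨hk, hj, -⟩ := deltaThree_support (left_ne_zero_of_smul hq)
    simp only [Pi.sub_apply, Matrix.cons_val_zero] at hS
    refine ⟨(q 1).toNat, ?_⟩
    funext j
    fin_cases j <;> simp <;> omega

theorem deltaThree_one_210 (F : ℤ → ℤ → U) (p m n : ℤ) {K₀ : ℕ}
    (h : ∀ k : ℕ, K₀ ≤ k → F (p + k) (m + n - k) = 0) :
    {q | deltaThree 1 2 1 0 q • seriesIn 0 2 1 F (![-p - 1, -m - 1, -n - 1] - q) ≠ 0}.Finite ∧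
    EventualSum (fun k => binom m k • F (p + k) (m + n - k))
      (formalMul (deltaThree 1 2 1 0) (seriesIn 0 2 1 F) ![-p - 1, -m - 1, -n - 1]) := by
  have hterm : ∀ k : ℕ, deltaThree 1 2 1 0 ![k, -m - 1, m - k] •
      seriesIn 0 2 1 F (![-p - 1, -m - 1, -n - 1] - ![(k : ℤ), -m - 1, m - k]) =
      binom m k • F (p + k) (m + n - k) := fun k => by
    have e1 : (k : ℤ) - (-p - 1) - 1 = p + k := by ring
    have e2 : m - (k : ℤ) - (-n - 1) - 1 = m + n - k := by ring
    have e3 : -m - 1 + (k : ℤ) = k - m - 1 := by ring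
    -- The delta function contributes (-1)^k C(k-m-1, k), because the exponent of x₂ is m - k; upper
    -- negation turns this into C(m, k).
    rw [binom_eq m k]
    simp [deltaThree, seriesIn, altBinom, binom, e1, e2, e3]
  have := finsum_eventualSum (φ := fun k : ℕ => (![k, -m - 1, m - k] : Fin 3 → ℤ))
    (f := fun q => deltaThree 1 2 1 0 q • seriesIn 0 2 1 F (![-p - 1, -m - 1, -n - 1] - q))
    (fun i j hij => by simpa using congrFun hij 0) (fun q hq => ?_) (K₀ := K₀)
    (fun k hk => by rw [hterm, h k hk, smul_zero])
  · simp only [hterm] at this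
    exact this
  · have hS := seriesIn_support (right_ne_zero_of_smul hq)
    obtain ⟨hk, hj, -⟩ := deltaThree_support (left_ne_zero_of_smul hq)
    simp only [Pi.sub_apply, Matrix.cons_val_zero, Matrix.cons_val_one] at hS
    refine ⟨(q 0).toNat, ?_⟩
    funext j
    fin_cases j <;> simp <;> omega

/-- Under lower truncation conditions the Jacobi identity is equivalent to the Borcherds
identity. -/
theorem jacobi_iff (YV : V → ℤ → Module.End ℂ V) (YU : V → ℤ → Module.End ℂ U) (u v : V) (w : U)
    (hu : ∃ N : ℤ, ∀ n, N ≤ n → YU u n w = 0) (hv : ∃ N : ℤ, ∀ n, N ≤ n → YU v n w = 0)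
    (huv : ∃ N : ℤ, ∀ l n, N ≤ l → YU (YV u l v) n w = 0) :
    Jacobi YV YU u v w ↔ ∀ p m n, EventualSum (borcherdsTerm YV YU u v w p m n) 0 := by
  obtain ⟨Nu, hu⟩ := hu
  obtain ⟨Nv, hv⟩ := hv
  obtain ⟨N, huv⟩ := huv
  -- In each product the inner operator is the one that vanishes for large `k`; this is where the
  -- three truncation hypotheses enter.
  have h1 := fun p m n => deltaThree_one_012 (fun m n => YU u m (YU v n w)) p m n
    (K₀ := (Nv - n).toNat) fun k hk => by rw [hv _ (by omega), map_zero]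
  have h2 := fun p m n => deltaThree_neg_021 (fun m n => YU v n (YU u m w)) p m n
    (K₀ := (Nu - m).toNat) fun k hk => by rw [hu _ (by omega), map_zero]
  have h3 := fun p m n => deltaThree_one_210 (fun l n => YU (YV u l v) n w) p m n
    (K₀ := (N - p).toNat) fun k hk => by rw [huv _ _ (by omega)]
  have he : ∀ e : Fin 3 → ℤ, ![-(-e 0 - 1) - 1, -(-e 1 - 1) - 1, -(-e 2 - 1) - 1] = e := by
    intro e
    funext j
    fin_cases j <;> simp
  constructor
  · rintro ⟨-, -, -, h⟩ p m n
    have := ((h1 p m n).2.sub (h2 p m n).2).sub (h3 p m n).2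
    rwa [← h, Pi.sub_apply, sub_self] at this
  · intro h
    refine ⟨fun e => ?_, fun e => ?_, fun e => ?_, ?_⟩
    · rw [← he e]
      exact (h1 _ _ _).1
    · rw [← he e]
      exact (h2 _ _ _).1
    · rw [← he e]
      exact (h3 _ _ _).1
    · funext e
      rw [← he e, Pi.sub_apply, ← sub_eq_zero]
      exact (((h1 _ _ _).2.sub (h2 _ _ _).2).sub (h3 _ _ _).2).unique (h _ _ _)

end Borcherds

/-! ## Laurent series with coefficients vanishing below a bound -/

section Laurent

instance laurentSMulCommClass : SMulCommClass ℂ (LaurentSeries ℂ) (LaurentSeries ℂ) where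
  smul_comm r f g := by
    rw [← HahnSeries.C_mul_eq_smul, ← HahnSeries.C_mul_eq_smul, smul_eq_mul, smul_eq_mul,
      mul_left_comm]

instance laurentIsScalarTower : IsScalarTower ℂ (LaurentSeries ℂ) (LaurentSeries ℂ) where
  smul_assoc r f g := by
    rw [← HahnSeries.C_mul_eq_smul, ← HahnSeries.C_mul_eq_smul, smul_eq_mul, smul_eq_mul,
      mul_assoc]

/-- The coefficients of `f` of index less than `a` vanish. -/
def VanishesBelow (f : LaurentSeries ℂ) (a : ℤ) : Prop := ∀ n < a, f.coeff n = 0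

theorem exists_vanishesBelow (f : LaurentSeries ℂ) : ∃ a, VanishesBelow f a :=
  ⟨f.order, fun _ hn => HahnSeries.coeff_eq_zero_of_lt_order hn⟩

variable {f g : LaurentSeries ℂ} {a b : ℤ}

theorem VanishesBelow.mono (h : VanishesBelow f a) (hab : b ≤ a) : VanishesBelow f b :=
  fun n hn => h n (lt_of_lt_of_le hn hab)

theorem VanishesBelow.mul (hf : VanishesBelow f a) (hg : VanishesBelow g b) :
    VanishesBelow (f * g) (a + b) := by
  intro n hn
  rw [HahnSeries.coeff_mul]
  refine Finset.sum_eq_zero fun ij hij => ?_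
  have := (Finset.mem_antidiagonal.mp hij).2.2
  rcases lt_or_ge ij.1 a with h | h
  · rw [hf _ h, zero_mul]
  · rw [hg ij.2 (by omega), mul_zero]

theorem vanishesBelow_single (n : ℤ) (r : ℂ) :
    VanishesBelow (HahnSeries.single n r : LaurentSeries ℂ) n :=
  fun _ hm => HahnSeries.coeff_single_of_ne (ne_of_lt hm)

/-- A Laurent series is the sum of finitely many monomials and a series of high order. -/
theorem exists_eq_sum_single_add (f : LaurentSeries ℂ) (M : ℤ) :
    ∃ (s : Finset ℤ) (h : LaurentSeries ℂ), VanishesBelow h M ∧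
      f = ∑ n ∈ s, f.coeff n • (HahnSeries.single n 1 : LaurentSeries ℂ) + h := by
  obtain ⟨a, ha⟩ := exists_vanishesBelow f
  refine ⟨Finset.Ico a M, f - ∑ n ∈ Finset.Ico a M,
    f.coeff n • (HahnSeries.single n 1 : LaurentSeries ℂ), fun n hn => ?_, by abel⟩
  rw [HahnSeries.coeff_sub, HahnSeries.coeff_sum]
  simp only [HahnSeries.coeff_smul, HahnSeries.coeff_single, smul_eq_mul, mul_ite, mul_one,
    mul_zero, Finset.sum_ite_eq, Finset.mem_Ico]
  split_ifs with h
  · exact sub_self _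
  · rw [ha n (by omega), sub_zero]

/-- A sequence of bilinear maps whose values vanish, uniformly along the sequence, as soon as the
order of one argument is large enough in terms of the other one. -/
structure UniformlyVanishing {W : Type*} [AddCommGroup W] [Module ℂ W]
    (H : ℕ → LaurentSeries ℂ →ₗ[ℂ] LaurentSeries ℂ →ₗ[ℂ] W) : Prop where
  left : ∀ g, ∃ M, ∀ f, VanishesBelow f M → ∀ k, H k f g = 0
  right : ∀ f, ∃ M, ∀ g, VanishesBelow g M → ∀ k, H k f g = 0

namespace UniformlyVanishing

variable {W : Type*} [AddCommGroup W] [Module ℂ W]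
  {H H' : ℕ → LaurentSeries ℂ →ₗ[ℂ] LaurentSeries ℂ →ₗ[ℂ] W}

theorem smul (h : UniformlyVanishing H) (c : ℕ → ℂ) : UniformlyVanishing fun k => c k • H k where
  left g := by
    obtain ⟨M, hM⟩ := h.left g
    exact ⟨M, fun f hf k => by simp [hM f hf k]⟩
  right f := by
    obtain ⟨M, hM⟩ := h.right f
    exact ⟨M, fun g hg k => by simp [hM g hg k]⟩

theorem sub (h : UniformlyVanishing H) (h' : UniformlyVanishing H') :
    UniformlyVanishing fun k => H k - H' k where
  left g := by
    obtain ⟨M, hM⟩ := h.left g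
    obtain ⟨M', hM'⟩ := h'.left g
    exact ⟨max M M', fun f hf k => by
      simp [hM f (hf.mono (le_max_left _ _)) k, hM' f (hf.mono (le_max_right _ _)) k]⟩
  right f := by
    obtain ⟨M, hM⟩ := h.right f
    obtain ⟨M', hM'⟩ := h'.right f
    exact ⟨max M M', fun g hg k => by
      simp [hM g (hg.mono (le_max_left _ _)) k, hM' g (hg.mono (le_max_right _ _)) k]⟩

theorem flip (h : UniformlyVanishing H) : UniformlyVanishing fun k => (H k).flip where
  left g := h.right g
  right f := h.left f

/-- An identity between eventual sums that holds for monomials holds for all Laurent series. -/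
theorem eventualSum (h : UniformlyVanishing H)
    (h0 : ∀ a b : ℤ, EventualSum (fun k => H k (HahnSeries.single a 1) (HahnSeries.single b 1)) 0)
    (f g : LaurentSeries ℂ) : EventualSum (fun k => H k f g) 0 := by
  have h1 : ∀ a : ℤ, EventualSum (fun k => H k (HahnSeries.single a 1) g) 0 := fun a => by
    -- Because `M` does not depend on `k`, a single splitting of the series into finitely many
    -- monomials and a negligible tail serves all terms of the sequence at once.
    obtain ⟨M, hM⟩ := h.right (HahnSeries.single a 1)
    obtain ⟨s, g', hg', hg⟩ := exists_eq_sum_single_add g M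
    have := EventualSum.sum (F := s) fun n _ => (h0 a n).const_smul (g.coeff n)
    simp only [smul_zero, Finset.sum_const_zero] at this
    refine this.congr fun k => ?_
    conv_rhs => rw [hg]
    simp [hM g' hg' k]
  obtain ⟨M, hM⟩ := h.left g
  obtain ⟨s, f', hf', hf⟩ := exists_eq_sum_single_add f M
  have := EventualSum.sum (F := s) fun n _ => (h1 n).const_smul (f.coeff n)
  simp only [smul_zero, Finset.sum_const_zero] at this
  refine this.congr fun k => ?_
  conv_rhs => rw [hf]
  simp [hM f' hf' k]

end UniformlyVanishing

theorem exists_bound {P : ℕ → ℤ → Prop} (hP : ∀ k M M', M ≤ M' → P k M → P k M')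
    (h : ∀ k, ∃ M, P k M) (K : ℕ) : ∃ M, ∀ k < K, P k M := by
  choose m hm using h
  obtain ⟨M, hM⟩ := ((Finset.range K).image m).exists_le
  exact ⟨M, fun k hk => hP k _ _
    (hM _ (Finset.mem_image_of_mem _ (Finset.mem_range.mpr hk))) (hm k)⟩

/-! ### Divided derivatives -/

/-- Multiplication of the coefficient of index `n` by `(ε n choose k)`. -/
def binomScale (ε : ℤ) (k : ℕ) : LaurentSeries ℂ →ₗ[ℂ] LaurentSeries ℂ where
  toFun f := ⟨fun n => binom (ε * n) k * f.coeff n,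
    f.isPWO_support.mono fun n hn => right_ne_zero_of_mul hn⟩
  map_add' f g := by
    ext n
    simp [mul_add]
  map_smul' a f := by
    ext n
    simp [mul_left_comm]

theorem coeff_binomScale (ε : ℤ) (k : ℕ) (f : LaurentSeries ℂ) (n : ℤ) :
    (binomScale ε k f).coeff n = binom (ε * n) k * f.coeff n := rfl

/-- The divided derivative `(1/k!) (d/dy)^k` of Laurent series in the variable `y^ε`, where
`ε = ±1`. -/
def hasse (ε : ℤ) (k : ℕ) : LaurentSeries ℂ →ₗ[ℂ] LaurentSeries ℂ :=
  LinearMap.mulLeft ℂ (HahnSeries.single (-(ε * k)) 1) ∘ₗ binomScale ε k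

theorem hasse_apply (ε : ℤ) (k : ℕ) (f : LaurentSeries ℂ) :
    hasse ε k f = HahnSeries.single (-(ε * k)) 1 * binomScale ε k f := rfl

theorem VanishesBelow.hasse (hf : VanishesBelow f a) (ε : ℤ) (k : ℕ) :
    VanishesBelow (hasse ε k f) (-(ε * k) + a) :=
  (vanishesBelow_single _ _).mul fun n hn => by rw [coeff_binomScale, hf n hn, mul_zero]

theorem hasse_single (ε : ℤ) (k : ℕ) (n : ℤ) :
    hasse ε k (HahnSeries.single n 1) =
      binom (ε * n) k • (HahnSeries.single (n - ε * k) 1 : LaurentSeries ℂ) := by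
  have : binomScale ε k (HahnSeries.single n 1) =
      binom (ε * n) k • (HahnSeries.single n 1 : LaurentSeries ℂ) := by
    ext m
    rw [coeff_binomScale, HahnSeries.coeff_smul, smul_eq_mul]
    rcases eq_or_ne m n with rfl | h
    · rfl
    · rw [HahnSeries.coeff_single_of_ne h, mul_zero, mul_zero]
  rw [hasse_apply, this, mul_smul_comm, HahnSeries.single_mul_single, mul_one, sub_eq_neg_add]

theorem hasse_zero (ε : ℤ) (f : LaurentSeries ℂ) : hasse ε 0 f = f := by
  ext n
  have : (HahnSeries.single (-(ε * ((0 : ℕ) : ℤ))) 1 : LaurentSeries ℂ) = 1 := by simp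
  rw [hasse_apply, this, one_mul, coeff_binomScale, binom_zero_right, one_mul]

/-- Leibniz rule for a product with the variable y = (y^ε)^ε, whose divided derivatives of order at
least two vanish. On coefficients it is Pascal's rule. -/
theorem hasse_succ_single_mul {ε : ℤ} (hε : ε * ε = 1) (k : ℕ) (f : LaurentSeries ℂ) :
    hasse ε (k + 1) (HahnSeries.single ε 1 * f) =
      HahnSeries.single ε 1 * hasse ε (k + 1) f + hasse ε k f := by
  have h : binomScale ε (k + 1) (HahnSeries.single ε 1 * f) =
      HahnSeries.single ε 1 * (binomScale ε (k + 1) f + binomScale ε k f) := by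
    ext n
    obtain ⟨m, rfl⟩ : ∃ m, n = m + ε := ⟨n - ε, by ring⟩
    rw [coeff_binomScale, HahnSeries.coeff_single_mul_add, HahnSeries.coeff_single_mul_add,
      HahnSeries.coeff_add, coeff_binomScale, coeff_binomScale, mul_add ε, hε, binom_succ_succ]
    ring
  have e : (HahnSeries.single (-(ε * ((k + 1 : ℕ) : ℤ))) 1 * HahnSeries.single ε 1 :
      LaurentSeries ℂ) = HahnSeries.single (-(ε * k)) 1 := by
    rw [HahnSeries.single_mul_single, mul_one,
      show -(ε * ((k + 1 : ℕ) : ℤ)) + ε = -(ε * k) by push_cast; ring]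
  rw [hasse_apply, hasse_apply, hasse_apply, h, ← e, mul_add, mul_add, mul_assoc,
    mul_left_comm (HahnSeries.single ε 1)]

/-- The variable `y - z` as a Laurent series in `y^ε`. -/
def shiftVar (ε : ℤ) (z : ℂ) : LaurentSeries ℂ := HahnSeries.single ε 1 - HahnSeries.C z

theorem shiftVar_ne_zero {ε : ℤ} (hε : ε * ε = 1) (z : ℂ) : shiftVar ε z ≠ 0 := by
  have hne : ε ≠ 0 := by
    rintro rfl
    simp at hε
  intro h
  have := congrArg (fun f => HahnSeries.coeff f ε) h
  simp [shiftVar, HahnSeries.C_apply, HahnSeries.coeff_single_of_ne hne] at this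

theorem hasse_succ_shiftVar_mul {ε : ℤ} (hε : ε * ε = 1) (z : ℂ) (k : ℕ) (f : LaurentSeries ℂ) :
    hasse ε (k + 1) (shiftVar ε z * f) =
      shiftVar ε z * hasse ε (k + 1) f + hasse ε k f := by
  have hC : ∀ f : LaurentSeries ℂ, HahnSeries.C z * f = z • f := fun f =>
    HahnSeries.C_mul_eq_smul
  rw [shiftVar, sub_mul, map_sub, hasse_succ_single_mul hε, sub_mul, hC, hC, map_smul]
  abel

/-- Negative exponents matter as well, so the induction on `m` runs in both directions; the Leibniz
rule links `m` and `m + 1`, and can be reversed because y - z is invertible. -/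
theorem hasse_shiftVar_zpow {ε : ℤ} (hε : ε * ε = 1) (z : ℂ) (k : ℕ) (m : ℤ) :
    hasse ε k (shiftVar ε z ^ m) = binom m k • shiftVar ε z ^ (m - k) := by
  have hT := shiftVar_ne_zero hε z
  induction k generalizing m with
  | zero => rw [hasse_zero, binom_zero_right, one_smul, Nat.cast_zero, sub_zero]
  | succ k ih =>
    have step : ∀ m : ℤ, hasse ε (k + 1) (shiftVar ε z ^ (m + 1)) =
        shiftVar ε z * hasse ε (k + 1) (shiftVar ε z ^ m) +
          binom m k • shiftVar ε z ^ (m - k) := fun m => by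
      rw [zpow_add_one₀ hT, mul_comm, hasse_succ_shiftVar_mul hε, ih]
    have e : ∀ m : ℤ, shiftVar ε z ^ (m - k) =
        shiftVar ε z * shiftVar ε z ^ (m - ((k + 1 : ℕ) : ℤ)) := fun m => by
      rw [mul_comm, ← zpow_add_one₀ hT]
      congr 1
      push_cast
      ring
    have e' : ∀ m : ℤ, m + 1 - ((k + 1 : ℕ) : ℤ) = m - k := fun m => by
      push_cast
      ring
    induction m using Int.induction_on with
    | zero =>
      have h1 : (shiftVar ε z ^ (0 : ℤ)) = HahnSeries.single 0 1 := by
        rw [zpow_zero]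
        rfl
      rw [h1, hasse_single, mul_zero, binom_zero_succ]
      have hz : ∀ f : LaurentSeries ℂ, (0 : ℂ) • f = 0 := fun f => zero_smul ℂ f
      rw [hz, hz]
    | succ m ihm =>
      rw [step, ihm, e', binom_succ_succ, mul_smul_comm, ← e]
      module
    | pred m ihm =>
      have := step (-(m : ℤ) - 1)
      rw [sub_add_cancel, ihm, ← sub_eq_iff_eq_add] at this
      refine mul_left_cancel₀ hT ?_
      rw [← this, mul_smul_comm, ← e]
      have h2 := binom_succ_succ (-(m : ℤ) - 1) k
      have h3 : -(m : ℤ) - ((k + 1 : ℕ) : ℤ) = -m - 1 - k := by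
        push_cast
        ring
      rw [sub_add_cancel] at h2
      rw [h2, h3]
      module

end Laurent

/-! ## The Borcherds identity for Laurent series -/

section Action

variable {V W : Type*} [AddCommGroup V] [Module ℂ V] [AddCommGroup W] [Module ℂ W]

/-- For given `v` and `w`, the element `v ⊗ f` annihilates `w` if the order of `f` is large. -/
def ContinuousAction (Θ : V ⊗[ℂ] LaurentSeries ℂ →ₗ[ℂ] Module.End ℂ W) : Prop :=
  ∀ v w, ∃ M, ∀ f, VanishesBelow f M → Θ (v ⊗ₜ f) w = 0

/-- The bilinear map `(f, g) ↦ (a ⊗ x^i f) (b ⊗ x^j g) w`. -/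
def iterAction (Θ : V ⊗[ℂ] LaurentSeries ℂ →ₗ[ℂ] Module.End ℂ W) (a b : V) (i j : ℤ) (w : W) :
    LaurentSeries ℂ →ₗ[ℂ] LaurentSeries ℂ →ₗ[ℂ] W :=
  LinearMap.mk₂ ℂ
    (fun f g => Θ (a ⊗ₜ (HahnSeries.single i 1 * f)) (Θ (b ⊗ₜ (HahnSeries.single j 1 * g)) w))
    (fun f f' g => by simp [mul_add, TensorProduct.tmul_add])
    (fun c f g => by simp [mul_smul_comm])
    (fun f g g' => by simp [mul_add, TensorProduct.tmul_add])
    (fun c f g => by simp [mul_smul_comm])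

/-- The bilinear map `(f, g) ↦ (a ⊗ (1/k!) f^(k) g) w`. -/
def hasseAction (Θ : V ⊗[ℂ] LaurentSeries ℂ →ₗ[ℂ] Module.End ℂ W) (a : V) (ε : ℤ) (k : ℕ) (w : W) :
    LaurentSeries ℂ →ₗ[ℂ] LaurentSeries ℂ →ₗ[ℂ] W :=
  LinearMap.mk₂ ℂ (fun f g => Θ (a ⊗ₜ (hasse ε k f * g)) w)
    (fun f f' g => by simp [add_mul, TensorProduct.tmul_add])
    (fun c f g => by simp [smul_mul_assoc])
    (fun f g g' => by simp [mul_add, TensorProduct.tmul_add])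
    (fun c f g => by simp [mul_smul_comm])

variable {Θ : V ⊗[ℂ] LaurentSeries ℂ →ₗ[ℂ] Module.End ℂ W}

/-- The factor y^(k+j) on the inner operator makes it vanish on `w` for large `k`, or for all `k ≥
0` once `g` has large order. When `g` is fixed only finitely many `k` remain, and each gives a bound
on the order of `f`. -/
theorem ContinuousAction.uniformlyVanishing_iter (hΘ : ContinuousAction Θ) (a b : V) (i : ℕ → ℤ)
    (j : ℤ) (w : W) : UniformlyVanishing fun k => iterAction Θ a b (i k) (k + j) w where
  left g := by
    obtain ⟨M, hM⟩ := hΘ b w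
    obtain ⟨γ, hγ⟩ := exists_vanishesBelow g
    obtain ⟨M', hM'⟩ := exists_bound
      (P := fun k M' => ∀ f, VanishesBelow f M' → iterAction Θ a b (i k) (k + j) w f g = 0)
      (fun k M₁ M₂ h h' f hf => h' f (hf.mono h))
      (fun k => by
        obtain ⟨M', hM'⟩ := hΘ a (Θ (b ⊗ₜ (HahnSeries.single (k + j) 1 * g)) w)
        exact ⟨M' - i k, fun f hf => hM' _
          (((vanishesBelow_single _ _).mul hf).mono (by omega))⟩)
      (M - γ - j).toNat
    refine ⟨M', fun f hf k => ?_⟩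
    rcases lt_or_ge k (M - γ - j).toNat with hk | hk
    · exact hM' k hk f hf
    · have := hM (HahnSeries.single (k + j) 1 * g)
        (((vanishesBelow_single _ _).mul hγ).mono (by omega))
      simp [iterAction, this]
  right f := by
    obtain ⟨M, hM⟩ := hΘ b w
    refine ⟨M - j, fun g hg k => ?_⟩
    have := hM (HahnSeries.single (k + j) 1 * g)
      (((vanishesBelow_single _ _).mul hg).mono (by omega))
    simp [iterAction, this]

/-- Only finitely many `a k` are nonzero, and for each of these `k` the divided derivative shifts
orders by a fixed amount. -/
theorem ContinuousAction.uniformlyVanishing_hasse (hΘ : ContinuousAction Θ) (a : ℕ → V)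
    (ha : ∃ K, ∀ k, K ≤ k → a k = 0) (ε : ℤ) (w : W) :
    UniformlyVanishing fun k => hasseAction Θ (a k) ε k w := by
  obtain ⟨K, hK⟩ := ha
  have key : ∀ γ, ∃ M, ∀ f g, (VanishesBelow f M ∧ VanishesBelow g γ ∨
      VanishesBelow f γ ∧ VanishesBelow g M) → ∀ k, hasseAction Θ (a k) ε k w f g = 0 := by
    intro γ
    obtain ⟨M, hM⟩ := exists_bound
      (P := fun k M => ∀ f g, (VanishesBelow f M ∧ VanishesBelow g γ ∨
        VanishesBelow f γ ∧ VanishesBelow g M) → hasseAction Θ (a k) ε k w f g = 0)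
      (fun k M₁ M₂ h h' f g hfg => h' f g
        (hfg.imp (fun h₀ => ⟨h₀.1.mono h, h₀.2⟩) fun h₀ => ⟨h₀.1, h₀.2.mono h⟩))
      (fun k => by
        obtain ⟨M, hM⟩ := hΘ (a k) w
        refine ⟨M - γ + ε * k, fun f g hfg => hM _ ?_⟩
        rcases hfg with h | h
        · exact ((h.1.hasse ε k).mul h.2).mono (by omega)
        · exact ((h.1.hasse ε k).mul h.2).mono (by omega))
      K
    refine ⟨M, fun f g hfg k => ?_⟩
    rcases lt_or_ge k K with hk | hk
    · exact hM k hk f g hfg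
    · simp [hasseAction, hK k hk]
  constructor
  · intro g
    obtain ⟨γ, hγ⟩ := exists_vanishesBelow g
    obtain ⟨M, hM⟩ := key γ
    exact ⟨M, fun f hf k => hM f g (.inl ⟨hf, hγ⟩) k⟩
  · intro f
    obtain ⟨γ, hγ⟩ := exists_vanishesBelow f
    obtain ⟨M, hM⟩ := key γ
    exact ⟨M, fun g hg k => hM f g (.inr ⟨hγ, hg⟩) k⟩

/-- The Borcherds identity for monomials implies the one for powers of `y - z`, expanded in
nonnegative powers of `y`. -/
theorem ContinuousAction.borcherds (hΘ : ContinuousAction Θ) (u v : V) (uv : ℤ → V) (p : ℤ) (w : W)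
    (huv : ∃ K : ℕ, ∀ k : ℕ, K ≤ k → uv (p + k) = 0)
    (h : ∀ a b : ℤ, EventualSum (fun k : ℕ =>
      altBinom p k • Θ (u ⊗ₜ HahnSeries.single (a + p - k) 1)
        (Θ (v ⊗ₜ HahnSeries.single (b + k) 1) w) -
      ((-1) ^ p * altBinom p k) • Θ (v ⊗ₜ HahnSeries.single (b + p - k) 1)
        (Θ (u ⊗ₜ HahnSeries.single (a + k) 1) w) -
      binom a k • Θ (uv (p + k) ⊗ₜ HahnSeries.single (a + b - k) 1) w) 0)
    (z : ℂ) (m n : ℤ) :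
    EventualSum (fun k : ℕ =>
      altBinom p k • Θ (u ⊗ₜ (HahnSeries.single (p - k) 1 * shiftVar 1 z ^ m))
        (Θ (v ⊗ₜ (HahnSeries.single (k : ℤ) 1 * shiftVar 1 z ^ n)) w) -
      ((-1) ^ p * altBinom p k) • Θ (v ⊗ₜ (HahnSeries.single (p - k) 1 * shiftVar 1 z ^ n))
        (Θ (u ⊗ₜ (HahnSeries.single (k : ℤ) 1 * shiftVar 1 z ^ m)) w) -
      binom m k • Θ (uv (p + k) ⊗ₜ (shiftVar 1 z ^ (m + n - k))) w) 0 := by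
  -- The flip keeps `f` attached to `u` and `g` attached to `v` in both orders of composition.
  have hU := (((hΘ.uniformlyVanishing_iter u v (fun k => p - k) 0 w).smul (altBinom p)).sub
    ((hΘ.uniformlyVanishing_iter v u (fun k => p - k) 0 w).flip.smul
      fun k => (-1) ^ p * altBinom p k)).sub
    (hΘ.uniformlyVanishing_hasse (fun k => uv (p + k)) huv 1 w)
  refine (hU.eventualSum (fun a b => (h a b).congr fun k => ?_)
    (shiftVar 1 z ^ m) (shiftVar 1 z ^ n)).congr fun k => ?_
  · simp only [iterAction, hasseAction, LinearMap.sub_apply, LinearMap.smul_apply,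
      LinearMap.flip_apply, LinearMap.mk₂_apply, HahnSeries.single_mul_single, mul_one, one_mul,
      hasse_single, smul_mul_assoc, TensorProduct.tmul_smul, map_smul, add_zero]
    rw [show a + p - (k : ℤ) = p - k + a by ring, show b + p - (k : ℤ) = p - k + b by ring,
      add_comm a (k : ℤ), add_comm b (k : ℤ), show a + b - (k : ℤ) = a - k + b by ring]
  · simp only [iterAction, hasseAction, LinearMap.sub_apply, LinearMap.smul_apply,
      LinearMap.flip_apply, LinearMap.mk₂_apply, hasse_shiftVar_zpow (mul_one 1),
      smul_mul_assoc, TensorProduct.tmul_smul, map_smul, add_zero]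
    rw [← zpow_add₀ (shiftVar_ne_zero (mul_one 1) z), show m - (k : ℤ) + n = m + n - k by ring]

/-- The Borcherds identity, in the opposite order, for monomials implies the one for powers of
`y - z`, expanded in nonnegative powers of `y⁻¹`. -/
theorem ContinuousAction.borcherds_opposite (hΘ : ContinuousAction Θ) (u v : V) (uv : ℤ → V)
    (p : ℤ) (w : W) (huv : ∃ K : ℕ, ∀ k : ℕ, K ≤ k → uv (p + k) = 0)
    (h : ∀ a b : ℤ, EventualSum (fun k : ℕ =>
      altBinom p k • Θ (v ⊗ₜ HahnSeries.single (-(b + k)) 1)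
        (Θ (u ⊗ₜ HahnSeries.single (-(a + p - k)) 1) w) -
      ((-1) ^ p * altBinom p k) • Θ (u ⊗ₜ HahnSeries.single (-(a + k)) 1)
        (Θ (v ⊗ₜ HahnSeries.single (-(b + p - k)) 1) w) -
      binom a k • Θ (uv (p + k) ⊗ₜ HahnSeries.single (-(a + b - k)) 1) w) 0)
    (z : ℂ) (m n : ℤ) :
    EventualSum (fun k : ℕ =>
      altBinom p k • Θ (v ⊗ₜ (HahnSeries.single (-(k : ℤ)) 1 * shiftVar (-1) z ^ n))
        (Θ (u ⊗ₜ (HahnSeries.single (-(p - k)) 1 * shiftVar (-1) z ^ m)) w) -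
      ((-1) ^ p * altBinom p k) • Θ (u ⊗ₜ (HahnSeries.single (-(k : ℤ)) 1 * shiftVar (-1) z ^ m))
        (Θ (v ⊗ₜ (HahnSeries.single (-(p - k)) 1 * shiftVar (-1) z ^ n)) w) -
      binom m k • Θ (uv (p + k) ⊗ₜ (shiftVar (-1) z ^ (m + n - k))) w) 0 := by
  have hε : (-1 : ℤ) * -1 = 1 := by norm_num
  have hU := (((hΘ.uniformlyVanishing_iter v u (fun k => -k) (-p) w).flip.smul (altBinom p)).sub
    ((hΘ.uniformlyVanishing_iter u v (fun k => -k) (-p) w).smul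
      fun k => (-1) ^ p * altBinom p k)).sub
    (hΘ.uniformlyVanishing_hasse (fun k => uv (p + k)) huv (-1) w)
  -- Series are in the variable y⁻¹ here, so the monomial of index `a` is y^(-a), which accounts for
  -- the signs.
  refine (hU.eventualSum (fun a b => (h (-a) (-b)).congr fun k => ?_)
    (shiftVar (-1) z ^ m) (shiftVar (-1) z ^ n)).congr fun k => ?_
  · simp only [iterAction, hasseAction, LinearMap.sub_apply, LinearMap.smul_apply,
      LinearMap.flip_apply, LinearMap.mk₂_apply, HahnSeries.single_mul_single, mul_one,
      hasse_single, smul_mul_assoc, TensorProduct.tmul_smul, map_smul, neg_one_mul]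
    rw [show -(-a + p - (k : ℤ)) = k + -p + a by ring,
      show -(-b + p - (k : ℤ)) = k + -p + b by ring,
      show -(-a + (k : ℤ)) = -k + a by ring, show -(-b + (k : ℤ)) = -k + b by ring,
      show -(-a + -b - (k : ℤ)) = a - -k + b by ring]
  · simp only [iterAction, hasseAction, LinearMap.sub_apply, LinearMap.smul_apply,
      LinearMap.flip_apply, LinearMap.mk₂_apply, hasse_shiftVar_zpow hε,
      smul_mul_assoc, TensorProduct.tmul_smul, map_smul]
    rw [← zpow_add₀ (shiftVar_ne_zero hε z), show m - (k : ℤ) + n = m + n - k by ring,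
      show -(p - (k : ℤ)) = k + -p by ring]

end Action

/-! ## Sums over triples with a given sum -/

section Triangle

open Finset.HasAntidiagonal (antidiagonal)

variable {M : Type*} [AddCommGroup M]

/-- The sum of `g i j k` over all `i + j + k = r`. -/
def tripleSum (g : ℕ → ℕ → ℕ → M) (r : ℕ) : M :=
  ∑ x ∈ antidiagonal r, ∑ y ∈ antidiagonal x.2, g x.1 y.1 y.2

theorem tripleSum_zero (g : ℕ → ℕ → ℕ → M) : tripleSum g 0 = g 0 0 0 := by
  simp [tripleSum]

theorem tripleSum_congr {g g' : ℕ → ℕ → ℕ → M} {r : ℕ}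
    (h : ∀ i j k, i + j + k = r → g i j k = g' i j k) : tripleSum g r = tripleSum g' r := by
  refine Finset.sum_congr rfl fun x hx => Finset.sum_congr rfl fun y hy => h _ _ _ ?_
  rw [Finset.HasAntidiagonal.mem_antidiagonal] at hx hy
  omega

theorem tripleSum_add (g g' : ℕ → ℕ → ℕ → M) (r : ℕ) :
    tripleSum (fun i j k => g i j k + g' i j k) r = tripleSum g r + tripleSum g' r := by
  simp [tripleSum, Finset.sum_add_distrib]

theorem map_tripleSum {N : Type*} [AddCommGroup N] (f : M →+ N) (g : ℕ → ℕ → ℕ → M) (r : ℕ) :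
    f (tripleSum g r) = tripleSum (fun i j k => f (g i j k)) r := by
  simp [tripleSum]

theorem sum_antidiagonal_shift_left (G : ℕ → ℕ → M) (h : ∀ j, G 0 j = 0) (r : ℕ) :
    ∑ x ∈ antidiagonal r, G (x.1 + 1) x.2 = ∑ x ∈ antidiagonal (r + 1), G x.1 x.2 := by
  rw [Finset.Nat.sum_antidiagonal_succ, h, zero_add]

theorem sum_antidiagonal_shift_right (G : ℕ → ℕ → M) (h : ∀ i, G i 0 = 0) (r : ℕ) :
    ∑ x ∈ antidiagonal r, G x.1 (x.2 + 1) = ∑ x ∈ antidiagonal (r + 1), G x.1 x.2 := by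
  rw [Finset.Nat.sum_antidiagonal_succ', h, zero_add]

theorem tripleSum_shift_fst (g : ℕ → ℕ → ℕ → M) (h : ∀ j k, g 0 j k = 0) (r : ℕ) :
    tripleSum (fun i j k => g (i + 1) j k) r = tripleSum g (r + 1) :=
  sum_antidiagonal_shift_left (fun i l => ∑ y ∈ antidiagonal l, g i y.1 y.2)
    (fun _ => Finset.sum_eq_zero fun _ _ => h _ _) r

theorem tripleSum_shift_snd (g : ℕ → ℕ → ℕ → M) (h : ∀ i k, g i 0 k = 0) (r : ℕ) :
    tripleSum (fun i j k => g i (j + 1) k) r = tripleSum g (r + 1) := by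
  simp only [tripleSum, sum_antidiagonal_shift_left (g _) (h _)]
  exact sum_antidiagonal_shift_right (fun i l => ∑ y ∈ antidiagonal l, g i y.1 y.2)
    (fun _ => by simp [h]) r

theorem tripleSum_shift_trd (g : ℕ → ℕ → ℕ → M) (h : ∀ i j, g i j 0 = 0) (r : ℕ) :
    tripleSum (fun i j k => g i j (k + 1)) r = tripleSum g (r + 1) := by
  simp only [tripleSum, sum_antidiagonal_shift_right (g _) (h _)]
  exact sum_antidiagonal_shift_right (fun i l => ∑ y ∈ antidiagonal l, g i y.1 y.2)
    (fun _ => by simp [h]) r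

/-- The support lies in an `I × J` box, which is contained in the triangle of size `S`. -/
theorem sum_range_sum_antidiagonal (G : ℕ → ℕ → M) {I J S : ℕ}
    (h : ∀ i j, I ≤ i ∨ J ≤ j → G i j = 0) (hS : I + J ≤ S) :
    ∑ s ∈ Finset.range S, ∑ x ∈ antidiagonal s, G x.1 x.2 =
      ∑ i ∈ Finset.range I, ∑ j ∈ Finset.range J, G i j := by
  simp only [Finset.Nat.sum_antidiagonal_eq_sum_range_succ_mk]
  rw [Finset.sum_range_diag_flip S G]
  refine (Finset.sum_subset_zero_on_sdiff (by simpa using by omega) (fun i hi => ?_)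
    fun i hi => ?_).symm
  · simp only [Finset.mem_sdiff, Finset.mem_range, not_lt] at hi
    exact Finset.sum_eq_zero fun j _ => h i j (.inl hi.2)
  · rw [Finset.mem_range] at hi
    refine Finset.sum_subset (by simpa using by omega) fun j _ hj => h i j (.inr ?_)
    simpa using hj

theorem sum_range_tripleSum (g : ℕ → ℕ → ℕ → M) {I J K S : ℕ}
    (h : ∀ i j k, I ≤ i ∨ J ≤ j ∨ K ≤ k → g i j k = 0) (hS : I + (J + K) ≤ S) :
    ∑ s ∈ Finset.range S, tripleSum g s =
      ∑ i ∈ Finset.range I, ∑ j ∈ Finset.range J, ∑ k ∈ Finset.range K, g i j k := by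
  rw [← Finset.sum_congr rfl fun i _ =>
    sum_range_sum_antidiagonal (g i) (fun j k hjk => h i j k (.inr hjk)) le_rfl]
  refine sum_range_sum_antidiagonal (fun i l => ∑ y ∈ antidiagonal l, g i y.1 y.2)
    (fun i l hil => Finset.sum_eq_zero fun y hy => h _ _ _ ?_) hS
  rw [Finset.HasAntidiagonal.mem_antidiagonal] at hy
  omega

end Triangle

theorem succ_mul_binom (n : ℤ) (k : ℕ) : ((k : ℂ) + 1) * binom n (k + 1) = (n - k) * binom n k := by
  have h := Ring.choose_smul_choose n (Nat.le_succ k)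
  rw [Nat.choose_succ_self_right, Nat.succ_sub (le_refl k), Nat.sub_self, Ring.choose_one_right,
    nsmul_eq_mul] at h
  have := congrArg (Int.cast : ℤ → ℂ) h
  push_cast at this
  rw [binom, binom, this]
  ring

/-! ## Divided powers of `L(1)` -/

section DividedPower

open Finset.HasAntidiagonal (antidiagonal)

/-- The divided power `(1/n!) Lⁿ`. -/
def dividedPower {U : Type*} [AddCommGroup U] [Module ℂ U] (L : Module.End ℂ U) (n : ℕ) :
    Module.End ℂ U := (n.factorial : ℂ)⁻¹ • L ^ n

theorem dividedPower_zero {U : Type*} [AddCommGroup U] [Module ℂ U] (L : Module.End ℂ U) (x : U) :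
    dividedPower L 0 x = x := by
  simp [dividedPower]

theorem apply_dividedPower {U : Type*} [AddCommGroup U] [Module ℂ U] (L : Module.End ℂ U) (n : ℕ)
    (x : U) : L (dividedPower L n x) = ((n : ℂ) + 1) • dividedPower L (n + 1) x := by
  have h : ((n : ℂ) + 1) * (((n + 1).factorial : ℕ) : ℂ)⁻¹ = (n.factorial : ℂ)⁻¹ := by
    have h1 : ((n : ℂ) + 1) ≠ 0 := by exact_mod_cast Nat.succ_ne_zero n
    have h2 : (n.factorial : ℂ) ≠ 0 := by exact_mod_cast n.factorial_ne_zero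
    rw [Nat.factorial_succ]
    push_cast
    field_simp
  simp only [dividedPower, LinearMap.smul_apply, map_smul, smul_smul, h, pow_succ',
    Module.End.mul_apply]

variable {A V : Type*} [AddCommGroup A] [AddCommGroup V] [Module ℂ V]
  (𝒱 : MobiusVertexAlgebra A V)

/-! ### Weights of products and the action of L(1) on them -/

theorem modes_Lneg (v : V) (n : ℤ) :
    modes 𝒱.Y (𝒱.L.Lneg v) (n + 1) = (-((n : ℂ) + 1)) • modes 𝒱.Y v n := by
  rw [𝒱.sl2.deriv_Y, add_sub_cancel_right]
  push_cast
  rfl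

/-- A vector of degree `α` that is an eigenvector of `L(0)` is homogeneous. -/
theorem mem_gr_of_Lzero {n : ℤ} {α : A} {x : V} (hdeg : x ∈ ⨆ k, 𝒱.gr k α)
    (hx : 𝒱.L.Lzero x = (n : ℂ) • x) : x ∈ 𝒱.gr n α := by
  have hE : ∀ k, ∀ y ∈ 𝒱.gr k α, y ∈ Module.End.eigenspace 𝒱.L.Lzero (k : ℂ) := fun k y hy =>
    Module.End.mem_eigenspace_iff.mpr (𝒱.weight k α y hy)
  have hsplit : ⨆ k, 𝒱.gr k α ≤ 𝒱.gr n α ⊔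
      ⨆ (μ : ℂ) (_ : μ ≠ (n : ℂ)), Module.End.eigenspace 𝒱.L.Lzero μ := by
    refine iSup_le fun k => ?_
    by_cases hk : k = n
    · rw [hk]
      exact le_sup_left
    · refine le_trans (fun y hy => ?_) le_sup_right
      exact Submodule.mem_iSup_of_mem (k : ℂ)
        (Submodule.mem_iSup_of_mem (by exact_mod_cast hk) (hE k y hy))
  obtain ⟨a, ha, b, hb, hab⟩ := Submodule.mem_sup.mp (hsplit hdeg)
  have hbE : b ∈ Module.End.eigenspace 𝒱.L.Lzero (n : ℂ) := by
    rw [show b = x - a by rw [← hab]; abel]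
    exact sub_mem (Module.End.mem_eigenspace_iff.mpr hx) (hE _ a ha)
  have hb0 : b = 0 := Submodule.disjoint_def.mp
    (Module.End.eigenspaces_iSupIndep 𝒱.L.Lzero (n : ℂ)) b hbE hb
  rw [← hab, hb0, add_zero]
  exact ha

/-- `u_q v` has weight `h + l - q - 1` for `u` of weight `h` and `v` of weight `l`. -/
theorem modes_mem_gr {h l : ℤ} {α β : A} {u v : V} (hu : u ∈ 𝒱.gr h α) (hv : v ∈ 𝒱.gr l β) (q : ℤ) :
    modes 𝒱.Y u q v ∈ 𝒱.gr (h + l - q - 1) (α + β) := by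
  refine mem_gr_of_Lzero 𝒱 (𝒱.Y_degree α β u (Submodule.mem_iSup_of_mem h hu) v
    (Submodule.mem_iSup_of_mem l hv) q) ?_
  have h0 := LinearMap.congr_fun (𝒱.sl2.zero_Y u q) v
  rw [Ring.lie_def, 𝒱.weight h α u hu, modes_smul, modes_Lneg] at h0
  simp only [LinearMap.sub_apply, Module.End.mul_apply, LinearMap.add_apply,
    LinearMap.smul_apply] at h0
  rw [𝒱.weight l β v hv, map_smul, sub_eq_iff_eq_add] at h0
  rw [h0]
  push_cast
  module

theorem Lone_modes {h : ℤ} {α : A} {u : V} (hu : u ∈ 𝒱.gr h α) (n : ℤ) (v : V) :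
    𝒱.L.Lone (modes 𝒱.Y u n v) = modes 𝒱.Y (𝒱.L.Lone u) n v +
      (2 * (h : ℂ) - n - 2) • modes 𝒱.Y u (n + 1) v + modes 𝒱.Y u n (𝒱.L.Lone v) := by
  have h0 := LinearMap.congr_fun (𝒱.sl2.one_Y u n) v
  rw [Ring.lie_def, 𝒱.weight h α u hu, modes_smul, show n + 2 = (n + 1) + 1 by ring,
    modes_Lneg] at h0
  simp only [LinearMap.sub_apply, Module.End.mul_apply, LinearMap.add_apply,
    LinearMap.smul_apply] at h0
  rw [sub_eq_iff_eq_add] at h0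
  rw [h0]
  push_cast
  module

theorem dividedPower_Lone_mem {h : ℤ} {α : A} {u : V} (hu : u ∈ 𝒱.gr h α) (i : ℕ) :
    dividedPower 𝒱.L.Lone i u ∈ 𝒱.gr (h - i) α := by
  rw [dividedPower, LinearMap.smul_apply]
  refine Submodule.smul_mem _ _ ?_
  induction i with
  | zero => simpa using hu
  | succ i ih =>
    rw [pow_succ', Module.End.mul_apply]
    have := Lone_mem 𝒱 _ _ _ ih
    rwa [show h - ((i + 1 : ℕ) : ℤ) = h - i - 1 by push_cast; ring]

/-- The action of the divided powers of `L(1)` on `u_q v`. -/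
theorem dividedPower_modes {h : ℤ} {α : A} {u : V} (hu : u ∈ 𝒱.gr h α) (q : ℤ) (v : V) (r : ℕ) :
    dividedPower 𝒱.L.Lone r (modes 𝒱.Y u q v) = tripleSum (fun i j k =>
      binom (2 * h - 2 - i - q) k • modes 𝒱.Y (dividedPower 𝒱.L.Lone i u) (q + k)
        (dividedPower 𝒱.L.Lone j v)) r := by
  induction r with
  | zero => simp [tripleSum_zero, dividedPower_zero, binom_zero_right]
  | succ r ih =>
    set g : ℕ → ℕ → ℕ → V := fun i j k => modes 𝒱.Y (dividedPower 𝒱.L.Lone i u) (q + k)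
      (dividedPower 𝒱.L.Lone j v) with hg
    set c : ℕ → ℕ → ℂ := fun i k => binom (2 * h - 2 - i - q) k with hc
    have hcsucc : ∀ i k : ℕ, binom (2 * h - 2 - (i + 1 : ℕ) - q + 1) k = c i k := fun i k => by
      rw [hc]
      congr 1
      push_cast
      ring
    -- Applying L(1) once more multiplies the divided power by r + 1, which on the right side is the
    -- total degree i + j + k; it is distributed over the three indices below.
    have step : 𝒱.L.Lone (dividedPower 𝒱.L.Lone r (modes 𝒱.Y u q v)) =
        tripleSum (fun i j k => ((i + j + k : ℕ) : ℂ) • c i k • g i j k) (r + 1) := by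
      rw [ih]
      refine (map_tripleSum 𝒱.L.Lone.toAddMonoidHom _ r).trans ?_
      -- [L(1), u_n] = (L(1)u)_n + (2h-n-2) u_(n+1) raises exactly one of `i`, `j`, `k`. The upper
      -- entry of the binomial in `e1` is increased by one so that after `i ↦ i + 1` it becomes `c i
      -- k` again; the correction subtracted in `e3` restores the total.
      have e1 := tripleSum_shift_fst (fun i j k =>
        ((i : ℂ) * binom (2 * h - 2 - i - q + 1) k) • g i j k) (by simp) r
      have e2 := tripleSum_shift_snd (fun i j k => ((j : ℂ) * c i k) • g i j k) (by simp) r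
      have e3 := tripleSum_shift_trd (fun i j k => ((k : ℂ) * c i k -
        i * (binom (2 * h - 2 - i - q + 1) k - c i k)) • g i j k) (by simp [hc, binom_zero_right]) r
      have e : tripleSum (fun i j k => ((i + j + k : ℕ) : ℂ) • c i k • g i j k) (r + 1) =
          tripleSum (fun i j k => ((i : ℂ) * binom (2 * h - 2 - i - q + 1) k) • g i j k) (r + 1) +
          tripleSum (fun i j k => ((j : ℂ) * c i k) • g i j k) (r + 1) +
          tripleSum (fun i j k => ((k : ℂ) * c i k -
            i * (binom (2 * h - 2 - i - q + 1) k - c i k)) • g i j k) (r + 1) := by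
        rw [← tripleSum_add, ← tripleSum_add]
        refine tripleSum_congr fun i j k _ => ?_
        push_cast
        module
      rw [e, ← e1, ← e2, ← e3, ← tripleSum_add, ← tripleSum_add]
      refine tripleSum_congr fun i j k _ => ?_
      have hk := succ_mul_binom (2 * h - 2 - i - q) k
      have hp := binom_succ_succ (2 * h - 2 - i - q) k
      change 𝒱.L.Lone (c i k • g i j k) = _
      rw [map_smul, hg]
      simp only
      rw [Lone_modes 𝒱 (dividedPower_Lone_mem 𝒱 hu i), apply_dividedPower, apply_dividedPower,
        modes_smul, hcsucc, hp]
      simp only [hc]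
      have hco : ((k : ℂ) + 1) * binom (2 * h - 2 - i - q) (k + 1) -
          i * (binom (2 * h - 2 - i - q) k + binom (2 * h - 2 - i - q) (k + 1) -
            binom (2 * h - 2 - i - q) (k + 1)) =
          (2 * ((h - i : ℤ) : ℂ) - ((q + k : ℤ) : ℂ) - 2) * binom (2 * h - 2 - i - q) k := by
        rw [hk]
        push_cast
        ring
      push_cast at hco ⊢
      rw [hco, map_smul, LinearMap.smul_apply, add_assoc q (k : ℤ) 1]
      module
    rw [apply_dividedPower] at step
    have hr : ((r : ℂ) + 1) ≠ 0 := by exact_mod_cast Nat.succ_ne_zero r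
    refine smul_right_injective V hr ?_
    simp only [step]
    refine Eq.trans (tripleSum_congr fun i j k hijk => ?_)
      (map_tripleSum (DistribSMul.toAddMonoidHom V ((r : ℂ) + 1)) _ _).symm
    rw [hijk]
    push_cast
    rfl

/-- The identity between vectors of a Möbius vertex algebra that underlies the Jacobi identity for
opposite vertex operators. -/
theorem tripleSum_modes_dividedPower {h : ℤ} {α : A} {u : V} (hu : u ∈ 𝒱.gr h α) (v : V) (s : ℕ)
    (a p : ℤ) :
    tripleSum (fun i j k => binom (2 * h - 2 - i - a - p) k •
      modes 𝒱.Y (dividedPower 𝒱.L.Lone i u) (p + k) (dividedPower 𝒱.L.Lone j v)) s =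
    ∑ x ∈ antidiagonal s,
      altBinom a x.1 • dividedPower 𝒱.L.Lone x.2 (modes 𝒱.Y u (p + x.1) v) := by
  induction s generalizing a p with
  | zero => simp [tripleSum_zero, dividedPower_zero, binom_zero_right, altBinom]
  | succ s ih =>
    set g : ℕ → ℕ → ℕ → V := fun i j k => modes 𝒱.Y (dividedPower 𝒱.L.Lone i u) (p + k)
      (dividedPower 𝒱.L.Lone j v) with hg
    set d : ℕ → ℕ → V := fun k r => dividedPower 𝒱.L.Lone r (modes 𝒱.Y u (p + k) v) with hd
    -- `hL` and `hR` show that, when `a` is replaced by `a + 1`, both sides of the claim change by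
    -- the same quantity. By Pascal's rule and the induction hypothesis this quantity is the
    -- identity of degree `s` with `p + 1` in place of `p`.
    have hL : ∀ a : ℤ, tripleSum (fun i j k => binom (2 * h - 2 - i - a - p) k • g i j k) (s + 1) =
        tripleSum (fun i j k => binom (2 * h - 2 - i - (a + 1) - p) k • g i j k) (s + 1) +
        ∑ x ∈ antidiagonal s, altBinom a x.1 • d (x.1 + 1) x.2 := by
      intro a
      have e : ∑ x ∈ antidiagonal s, altBinom a x.1 • d (x.1 + 1) x.2 =
          tripleSum (fun i j k => (binom (2 * h - 2 - i - a - p) k -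
            binom (2 * h - 2 - i - (a + 1) - p) k) • g i j k) (s + 1) := by
        rw [← tripleSum_shift_trd _ (by simp [binom_zero_right])]
        have hd1 : ∀ k r : ℕ, d (k + 1) r =
            dividedPower 𝒱.L.Lone r (modes 𝒱.Y u (p + 1 + k) v) := fun k r => by
          simp only [hd]
          rw [show p + ((k + 1 : ℕ) : ℤ) = p + 1 + k by push_cast; ring]
        simp only [hd1]
        rw [← ih a (p + 1)]
        refine tripleSum_congr fun i j k _ => ?_
        have hp := binom_succ_succ (2 * h - 2 - i - a - (p + 1)) k
        rw [show 2 * h - 2 - i - a - (p + 1) + 1 = 2 * h - 2 - i - a - p by ring] at hp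
        rw [show 2 * h - 2 - i - (a + 1) - p = 2 * h - 2 - i - a - (p + 1) by ring, hp,
          add_sub_cancel_right, hg]
        simp only [Nat.cast_add, Nat.cast_one]
        rw [show p + ((k : ℤ) + 1) = p + 1 + k by ring]
      rw [e, ← tripleSum_add]
      refine tripleSum_congr fun i j k _ => ?_
      module
    have hR : ∀ a : ℤ, ∑ x ∈ antidiagonal (s + 1), altBinom a x.1 • d x.1 x.2 =
        ∑ x ∈ antidiagonal (s + 1), altBinom (a + 1) x.1 • d x.1 x.2 +
        ∑ x ∈ antidiagonal s, altBinom a x.1 • d (x.1 + 1) x.2 := by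
      intro a
      rw [Finset.Nat.sum_antidiagonal_succ, Finset.Nat.sum_antidiagonal_succ, add_assoc,
        ← Finset.sum_add_distrib]
      congr 1
      · simp [altBinom, binom_zero_right]
      · refine Finset.sum_congr rfl fun x _ => ?_
        rw [altBinom_succ_succ]
        module
    -- For `a = 0` only one summand on the right survives, and the claim is `dividedPower_modes`;
    -- the recursions then reach every integer.
    induction a using Int.induction_on with
    | zero =>
      rw [Finset.Nat.sum_antidiagonal_succ, Finset.sum_eq_zero fun x _ => by
        rw [altBinom, binom_zero_succ, mul_zero, zero_smul]]
      simp only [altBinom, binom_zero_right, Nat.cast_zero, add_zero, pow_zero, one_mul,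
        one_smul, dividedPower_modes 𝒱 hu, sub_zero]
    | succ a iha => exact add_right_cancel ((hL a).symm.trans (iha.trans (hR a)))
    | pred a iha =>
      rw [hL, hR, sub_add_cancel, iha]

end DividedPower

/-! ## Opposite vertex operators -/

section Opposite

variable {V W : Type*} [AddCommGroup V] [Module ℂ V] [AddCommGroup W] [Module ℂ W]

theorem tauW_tmul (Y : V →ₗ[ℂ] VertexOperator ℂ W) (v : V) (f : LaurentSeries ℂ) (w : W) :
    tauW Y (v ⊗ₜ f) w = ∑ᶠ n : ℤ, f.coeff n • modes Y v n w := rfl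

theorem tauW_tmul_single (Y : V →ₗ[ℂ] VertexOperator ℂ W) (v : V) (n : ℤ) :
    tauW Y (v ⊗ₜ HahnSeries.single n 1) = modes Y v n := by
  ext w
  rw [tauW_tmul, finsum_eq_single _ n]
  · simp
  · intro m hm
    rw [HahnSeries.coeff_single_of_ne hm, zero_smul]

theorem continuousAction_tauW (Y : V →ₗ[ℂ] VertexOperator ℂ W) : ContinuousAction (tauW Y) := by
  intro v w
  obtain ⟨N, hN⟩ := modes_trunc Y v w
  refine ⟨N, fun f hf => ?_⟩
  rw [tauW_tmul, ← finsum_zero (α := ℤ)]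
  refine finsum_congr fun n => ?_
  rcases lt_or_ge n N with hn | hn
  · rw [hf n hn, zero_smul]
  · rw [hN n hn, smul_zero]

variable {A : Type*} [AddCommGroup A] (𝒱 : MobiusVertexAlgebra A V)

theorem oppMap_tmul (v : V) (f : LaurentSeries ℂ) :
    oppMap 𝒱 (v ⊗ₜ f) =
      LinearMap.lTensor V (Algebra.lmul ℂ (LaurentSeries ℂ) f) (opp 𝒱 v) := rfl

/-- The element v^o is a finite sum of tensors, and multiplication by a fixed series shifts orders
by a bounded amount. -/
theorem continuousAction_tauW_oppMap (Y : V →ₗ[ℂ] VertexOperator ℂ W) :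
    ContinuousAction (tauW Y ∘ₗ oppMap 𝒱) := by
  intro v w
  have key : ∀ ξ : V ⊗[ℂ] LaurentSeries ℂ, ∃ M, ∀ f, VanishesBelow f M →
      tauW Y (LinearMap.lTensor V (Algebra.lmul ℂ (LaurentSeries ℂ) f) ξ) w = 0 := by
    intro ξ
    induction ξ using TensorProduct.induction_on with
    | zero => exact ⟨0, fun f _ => by simp⟩
    | tmul x g =>
      obtain ⟨M, hM⟩ := continuousAction_tauW Y x w
      obtain ⟨γ, hγ⟩ := exists_vanishesBelow g
      exact ⟨M - γ, fun f hf => hM (f * g) ((hf.mul hγ).mono (by omega))⟩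
    | add x y hx hy =>
      obtain ⟨M, hM⟩ := hx
      obtain ⟨M', hM'⟩ := hy
      refine ⟨max M M', fun f hf => ?_⟩
      rw [map_add, map_add, LinearMap.add_apply, hM f (hf.mono (le_max_left _ _)),
        hM' f (hf.mono (le_max_right _ _)), add_zero]
  obtain ⟨M, hM⟩ := key (opp 𝒱 v)
  exact ⟨M, fun f hf => hM f hf⟩

theorem opp_of_mem {h : ℤ} {α : A} {v : V} (hv : v ∈ 𝒱.gr h α) :
    opp 𝒱 v = oppWeight 𝒱 h v := by
  classical
  have : (LinearEquiv.ofBijective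
      (DirectSum.coeLinearMap fun p : ℤ × A => 𝒱.gr p.1 p.2) (gr_bijective _)).symm v =
      DirectSum.lof ℂ (ℤ × A) (fun p => 𝒱.gr p.1 p.2) (h, α) ⟨v, hv⟩ := by
    rw [LinearEquiv.symm_apply_eq, LinearEquiv.ofBijective_apply, DirectSum.coeLinearMap_lof]
  rw [opp, LinearMap.comp_apply, LinearEquiv.coe_coe]
  erw [this, DirectSum.toModule_lof]
  rfl

theorem dividedPower_Lone_nilpotent (v : V) :
    ∃ M : ℕ, ∀ m, M ≤ m → dividedPower 𝒱.L.Lone m v = 0 := by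
  obtain ⟨M, hM⟩ := Lone_nilpotent 𝒱 v
  exact ⟨M, fun m hm => by rw [dividedPower, LinearMap.smul_apply, hM m hm, smul_zero]⟩

/-- The components of the opposite vertex operator of a homogeneous vector. -/
theorem tauW_oppMap_single (Y : V →ₗ[ℂ] VertexOperator ℂ W) {h : ℤ} {α : A} {v : V}
    (hv : v ∈ 𝒱.gr h α) {M : ℕ} (hM : ∀ m, M ≤ m → dividedPower 𝒱.L.Lone m v = 0) (n : ℤ) :
    (tauW Y ∘ₗ oppMap 𝒱) (v ⊗ₜ HahnSeries.single (-n) 1) = (-1 : ℂ) ^ h • ∑ m ∈ Finset.range M,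
      modes Y (dividedPower 𝒱.L.Lone m v) (2 * h - 2 - m - n) := by
  have hsum : opp 𝒱 v = (-1 : ℂ) ^ h • ∑ m ∈ Finset.range M, (dividedPower 𝒱.L.Lone m v) ⊗ₜ[ℂ]
      (HahnSeries.single (2 * h - 2 - m) 1 : LaurentSeries ℂ) := by
    rw [opp_of_mem 𝒱 hv]
    change (-1 : ℂ) ^ h • (∑ᶠ m : ℕ, ((m.factorial : ℂ)⁻¹ • (𝒱.L.Lone ^ m) v) ⊗ₜ[ℂ]
      (HahnSeries.single (2 * h - 2 - m) 1 : LaurentSeries ℂ)) = _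
    congr 1
    refine finsum_eq_finsetSum_of_support_subset _ fun m hm => ?_
    rw [Finset.coe_range, Set.mem_Iio]
    by_contra hc
    refine hm ?_
    have := hM m (not_lt.mp hc)
    rw [dividedPower, LinearMap.smul_apply] at this
    simp only [this, TensorProduct.zero_tmul]
  have hmul : ∀ f g : LaurentSeries ℂ, Algebra.lmul ℂ (LaurentSeries ℂ) f g = f * g :=
    fun _ _ => rfl
  rw [LinearMap.comp_apply, oppMap_tmul, hsum]
  simp only [map_smul, map_sum, LinearMap.lTensor_tmul, hmul,
    HahnSeries.single_mul_single, mul_one, tauW_tmul_single]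
  congr 1
  refine Finset.sum_congr rfl fun m _ => ?_
  congr 1
  ring

/-- The part of the Jacobi identity for opposite vertex operators that comes from the vertex
algebra. -/
theorem eventualSum_opposite_iterate (Y : V →ₗ[ℂ] VertexOperator ℂ W) {h l : ℤ} {α β : A} {u v : V}
    (hu : u ∈ 𝒱.gr h α) (hv : v ∈ 𝒱.gr l β) (w : W) (p a b : ℤ) {I J : ℕ}
    (hI : ∀ i, I ≤ i → dividedPower 𝒱.L.Lone i u = 0)
    (hJ : ∀ j, J ≤ j → dividedPower 𝒱.L.Lone j v = 0) :
    EventualSum (fun k : ℕ =>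
      ((-1 : ℂ) ^ p * (-1) ^ h * (-1) ^ l) • (∑ i ∈ Finset.range I, ∑ j ∈ Finset.range J,
        binom (2 * h - 2 - i - a - p) k •
          modes Y (modes 𝒱.Y (dividedPower 𝒱.L.Lone i u) (p + k) (dividedPower 𝒱.L.Lone j v))
            (2 * h - 2 - i - a - p + (2 * l - 2 - j - b - p) - k) w) +
      binom a k • (tauW Y ∘ₗ oppMap 𝒱) (modes 𝒱.Y u (p + k) v ⊗ₜ
        HahnSeries.single (-(a + b - k)) 1) w) 0 := by
  set x : ℕ → ℕ → ℕ → V := fun i j k =>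
    modes 𝒱.Y (dividedPower 𝒱.L.Lone i u) (p + k) (dividedPower 𝒱.L.Lone j v) with hx
  set y : ℕ → V := fun k => modes 𝒱.Y u (p + k) v with hy
  -- Every mode that occurs has index `D` minus the total degree, which is i + j + k in the triple
  -- sum and k + r in the double one.
  set D : ℤ := 2 * h + 2 * l - 4 - 2 * p - a - b with hD
  change EventualSum (fun k : ℕ =>
    ((-1 : ℂ) ^ p * (-1) ^ h * (-1) ^ l) • (∑ i ∈ Finset.range I, ∑ j ∈ Finset.range J,
      binom (2 * h - 2 - i - a - p) k • modes Y (x i j k)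
        (2 * h - 2 - i - a - p + (2 * l - 2 - j - b - p) - k) w) +
    binom a k • (tauW Y ∘ₗ oppMap 𝒱) (y k ⊗ₜ HahnSeries.single (-(a + b - k)) 1) w) 0
  obtain ⟨N, hN⟩ := modes_trunc 𝒱.Y u v
  -- A bound on `k` uniform in `i` and `j` exists because the divided powers vanish outside a finite
  -- box.
  have hKx : ∃ K : ℕ, ∀ i j k, K ≤ k → x i j k = 0 := by
    have h1 : ∀ i j, ∃ K : ℤ, ∀ k : ℕ, K ≤ k → x i j k = 0 := fun i j => by
      obtain ⟨N, hN⟩ := modes_trunc 𝒱.Y (dividedPower 𝒱.L.Lone i u) (dividedPower 𝒱.L.Lone j v)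
      exact ⟨N - p, fun k hk => hN _ (by omega)⟩
    have h2 : ∀ i, ∃ K : ℤ, ∀ j < J, ∀ k : ℕ, K ≤ k → x i j k = 0 := fun i =>
      exists_bound (P := fun j K => ∀ k : ℕ, K ≤ k → x i j k = 0)
        (fun j K K' hK h k hk => h k (hK.trans hk)) (h1 i) J
    obtain ⟨K, hK⟩ := exists_bound (P := fun i K => ∀ j < J, ∀ k : ℕ, K ≤ k → x i j k = 0)
        (fun j K K' hK h j hj k hk => h j hj k (hK.trans hk)) h2 I
    refine ⟨K.toNat, fun i j k hk => ?_⟩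
    rcases lt_or_ge i I with hi | hi
    · rcases lt_or_ge j J with hj | hj
      · exact hK i hi j hj k (by omega)
      · simp only [hx, hJ j hj, map_zero]
    · simp only [hx, hI i hi, modes, map_zero, Pi.zero_apply, LinearMap.zero_apply]
  obtain ⟨K₁, hK₁⟩ := hKx
  obtain ⟨K₂, hK₂⟩ : ∃ K₂ : ℕ, ∀ k, K₂ ≤ k → y k = 0 :=
    ⟨(N - p).toNat, fun k hk => hN _ (by omega)⟩
  obtain ⟨R, hR⟩ : ∃ R : ℤ, ∀ k < K₂, ∀ r : ℕ, R ≤ r → dividedPower 𝒱.L.Lone r (y k) = 0 :=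
    exists_bound (P := fun k R => ∀ r : ℕ, R ≤ r → dividedPower 𝒱.L.Lone r (y k) = 0)
      (fun k R R' hR h r hr => h r (hR.trans hr))
      (fun k => by
        obtain ⟨M, hM⟩ := dividedPower_Lone_nilpotent 𝒱 (y k)
        exact ⟨M, fun r hr => hM r (by exact_mod_cast hr)⟩) K₂
  have hR' : ∀ k r, R.toNat ≤ r → dividedPower 𝒱.L.Lone r (y k) = 0 := fun k r hr => by
    rcases lt_or_ge k K₂ with hk | hk
    · exact hR k hk r (by omega)
    · rw [hK₂ k hk, map_zero]
  have hmz : ∀ n, modes Y 0 n w = 0 := fun n => by simp [modes]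
  have hopp : ∀ k : ℕ, binom a k • (tauW Y ∘ₗ oppMap 𝒱) (y k ⊗ₜ
        HahnSeries.single (-(a + b - k)) 1) w =
      -(((-1 : ℂ) ^ p * (-1) ^ h * (-1) ^ l) • ∑ r ∈ Finset.range R.toNat,
        altBinom a k • modes Y (dividedPower 𝒱.L.Lone r (y k)) (D - k - r) w) := by
    intro k
    rw [tauW_oppMap_single 𝒱 Y (modes_mem_gr 𝒱 hu hv (p + k)) (hR' k), LinearMap.smul_apply,
      LinearMap.sum_apply, smul_smul, Finset.smul_sum, Finset.smul_sum, ← Finset.sum_neg_distrib]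
    refine Finset.sum_congr rfl fun r _ => ?_
    have h1 : (-1 : ℂ) ≠ 0 := by norm_num
    -- The exponent is the weight of u_(p+k) v; its factor (-1)^k turns C(a,k) into the alternating
    -- coefficient.
    have hs : (-1 : ℂ) ^ (h + l - (p + k) - 1) = -((-1) ^ p * (-1) ^ h * (-1) ^ l * (-1) ^ k) := by
      rw [zpow_sub_one₀ h1, zpow_sub₀ h1, zpow_add₀ h1, zpow_add₀ h1, zpow_natCast]
      have hp : ((-1 : ℂ) ^ p)⁻¹ = (-1) ^ p := by rw [← inv_zpow]; norm_num
      have hk : ((-1 : ℂ) ^ k)⁻¹ = (-1) ^ k := by rw [← inv_pow]; norm_num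
      rw [div_eq_mul_inv, mul_inv, hp, hk]
      ring
    rw [show 2 * (h + l - (p + (k : ℤ)) - 1) - 2 - r - (a + b - k) = D - k - r by rw [hD]; ring,
      hs, altBinom]
    module
  refine ⟨K₁ + K₂, fun K hK => ?_⟩
  rw [Finset.sum_add_distrib, ← Finset.smul_sum]
  simp only [hopp]
  rw [Finset.sum_neg_distrib, ← Finset.smul_sum, ← sub_eq_add_neg, ← smul_sub]
  -- The same large `S` is used for the triple and the double sum, so that they can be compared
  -- degree by degree.
  have e1 := sum_range_tripleSum (fun i j k => binom (2 * h - 2 - i - a - p) k •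
      modes Y (x i j k) (D - i - j - k) w) (I := I) (J := J) (K := K)
    (S := I + (J + K) + (K + R.toNat)) (fun i j k hijk => by
      have : x i j k = 0 := by
        rcases hijk with hi | hj | hk
        · simp only [hx, hI i hi, modes, map_zero, Pi.zero_apply, LinearMap.zero_apply]
        · simp only [hx, hJ j hj, map_zero]
        · exact hK₁ i j k (by omega)
      rw [this, hmz, smul_zero]) (by omega)
  have e2 := sum_range_sum_antidiagonal (fun k r => altBinom a k •
      modes Y (dividedPower 𝒱.L.Lone r (y k)) (D - k - r) w) (I := K) (J := R.toNat)
    (S := I + (J + K) + (K + R.toNat)) (fun k r hkr => by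
      have : dividedPower 𝒱.L.Lone r (y k) = 0 := by
        rcases hkr with hk | hr
        · rw [hK₂ k (by omega), map_zero]
        · exact hR' k r hr
      rw [this, hmz, smul_zero]) (by omega)
  have e3 : ∑ k ∈ Finset.range K, ∑ i ∈ Finset.range I, ∑ j ∈ Finset.range J,
      binom (2 * h - 2 - i - a - p) k • modes Y (x i j k)
        (2 * h - 2 - i - a - p + (2 * l - 2 - j - b - p) - k) w =
      ∑ i ∈ Finset.range I, ∑ j ∈ Finset.range J, ∑ k ∈ Finset.range K,
        binom (2 * h - 2 - i - a - p) k • modes Y (x i j k) (D - i - j - k) w := by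
    rw [Finset.sum_comm]
    refine Finset.sum_congr rfl fun i _ => ?_
    rw [Finset.sum_comm]
    refine Finset.sum_congr rfl fun j _ => Finset.sum_congr rfl fun k _ => ?_
    rw [show 2 * h - 2 - i - a - p + (2 * l - 2 - j - b - p) - k = D - i - j - k by
      rw [hD]; ring]
  rw [e3, ← e1, ← e2, sub_eq_zero.mpr, smul_zero]
  refine Finset.sum_congr rfl fun s _ => ?_
  -- In total degree `s` all modes have index `D - s`, so one additive map carries the identity in
  -- `V` to the required identity in `W`.
  let φ : V →+ W := ⟨⟨fun x => modes Y x (D - s) w, hmz _⟩, fun x x' => by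
    change modes Y (x + x') (D - s) w = modes Y x (D - s) w + modes Y x' (D - s) w
    rw [modes_add, LinearMap.add_apply]⟩
  have hφ : ∀ (c : ℂ) x, φ (c • x) = c • modes Y x (D - s) w := fun c x => by
    change modes Y (c • x) (D - s) w = _
    rw [modes_smul, LinearMap.smul_apply]
  have key := congrArg φ (tripleSum_modes_dividedPower 𝒱 hu v s a p)
  rw [map_tripleSum, map_sum] at key
  simp only [hφ] at key
  refine Eq.trans (tripleSum_congr fun i j k hijk => ?_) (key.trans (Finset.sum_congr rfl
    fun z hz => ?_))
  · rw [show D - (i : ℤ) - j - k = D - s by rw [← hijk]; push_cast; ring]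
  · rw [Finset.HasAntidiagonal.mem_antidiagonal] at hz
    rw [show D - (z.1 : ℤ) - z.2 = D - s by rw [← hz]; push_cast; ring]

/-- The Jacobi identity for opposite vertex operators. -/
theorem borcherds_opposite (Y : V →ₗ[ℂ] VertexOperator ℂ W)
    (hY : ∀ u v w, Jacobi (modes 𝒱.Y) (modes Y) u v w) (u v : V) (w : W) (p a b : ℤ) :
    EventualSum (fun k : ℕ =>
      altBinom p k • (tauW Y ∘ₗ oppMap 𝒱) (v ⊗ₜ HahnSeries.single (-(b + k)) 1)
        ((tauW Y ∘ₗ oppMap 𝒱) (u ⊗ₜ HahnSeries.single (-(a + p - k)) 1) w) -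
      ((-1) ^ p * altBinom p k) • (tauW Y ∘ₗ oppMap 𝒱) (u ⊗ₜ HahnSeries.single (-(a + k)) 1)
        ((tauW Y ∘ₗ oppMap 𝒱) (v ⊗ₜ HahnSeries.single (-(b + p - k)) 1) w) -
      binom a k • (tauW Y ∘ₗ oppMap 𝒱) (modes 𝒱.Y u (p + k) v ⊗ₜ
        HahnSeries.single (-(a + b - k)) 1) w) 0 := by
  set Θ := tauW Y ∘ₗ oppMap 𝒱 with hΘ
  have hhom : ∀ q : ℤ × A, ∀ u ∈ 𝒱.gr q.1 q.2, ∀ q' : ℤ × A, ∀ v ∈ 𝒱.gr q'.1 q'.2,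
      EventualSum (fun k : ℕ => altBinom p k • Θ (v ⊗ₜ HahnSeries.single (-(b + k)) 1)
        (Θ (u ⊗ₜ HahnSeries.single (-(a + p - k)) 1) w) -
      ((-1) ^ p * altBinom p k) • Θ (u ⊗ₜ HahnSeries.single (-(a + k)) 1)
        (Θ (v ⊗ₜ HahnSeries.single (-(b + p - k)) 1) w) -
      binom a k • Θ (modes 𝒱.Y u (p + k) v ⊗ₜ HahnSeries.single (-(a + b - k)) 1) w) 0 := by
    rintro ⟨h, α⟩ u hu ⟨l, β⟩ v hv
    dsimp only at hu hv
    obtain ⟨I, hI⟩ := dividedPower_Lone_nilpotent 𝒱 u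
    obtain ⟨J, hJ⟩ := dividedPower_Lone_nilpotent 𝒱 v
    -- The opposite mode of y^(a+k) sends L(1)^i u / i! to the mode of index 2h-2-i-(a+k). The
    -- indices are chosen so that this equals m + p - k with m = 2h-2-i-a-p, and likewise for `v`.
    have hB : ∀ i j : ℕ, _ := fun i j => (jacobi_iff (modes 𝒱.Y) (modes Y)
      (dividedPower 𝒱.L.Lone i u) (dividedPower 𝒱.L.Lone j v) w (modes_trunc Y _ w)
      (modes_trunc Y _ w) (by
        obtain ⟨N, hN⟩ := modes_trunc 𝒱.Y (dividedPower 𝒱.L.Lone i u)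
          (dividedPower 𝒱.L.Lone j v)
        exact ⟨N, fun l n hl => by rw [hN l hl]; simp [modes]⟩)).mp (hY _ _ _) p
      (2 * h - 2 - i - a - p) (2 * l - 2 - j - b - p)
    have hS := (EventualSum.sum (F := Finset.range I) fun i _ =>
      EventualSum.sum (F := Finset.range J) fun j _ => hB i j).const_smul
        ((-1 : ℂ) ^ p * (-1) ^ h * (-1) ^ l)
    have hT := eventualSum_opposite_iterate 𝒱 Y hu hv w p a b hI hJ
    -- Passing to opposite operators reverses the order of composition, so the two product terms
    -- trade places up to the sign (-1)^p, which explains the scaling and the negation.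
    have := (hS.add hT).neg
    simp only [Finset.sum_const_zero, smul_zero, add_zero, neg_zero] at this
    refine this.congr fun k => ?_
    rw [← hΘ]
    have hpp : (-1 : ℂ) ^ p * (-1) ^ p = 1 := by rw [← mul_zpow]; norm_num
    have e1 : Θ (v ⊗ₜ HahnSeries.single (-(b + k)) 1)
        (Θ (u ⊗ₜ HahnSeries.single (-(a + p - k)) 1) w) = ((-1 : ℂ) ^ h * (-1) ^ l) •
        ∑ i ∈ Finset.range I, ∑ j ∈ Finset.range J, modes Y (dividedPower 𝒱.L.Lone j v)
          (2 * l - 2 - j - b - p + p - k) (modes Y (dividedPower 𝒱.L.Lone i u)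
            (2 * h - 2 - i - a - p + k) w) := by
      rw [hΘ, tauW_oppMap_single 𝒱 Y hu hI, tauW_oppMap_single 𝒱 Y hv hJ]
      simp only [LinearMap.smul_apply, LinearMap.sum_apply, map_smul, map_sum, Finset.smul_sum,
        smul_smul]
      refine Finset.sum_congr rfl fun i _ => Finset.sum_congr rfl fun j _ => ?_
      rw [show 2 * l - 2 - (j : ℤ) - b - p + p - k = 2 * l - 2 - j - (b + k) by ring,
        show 2 * h - 2 - (i : ℤ) - a - p + k = 2 * h - 2 - i - (a + p - k) by ring]
    have e2 : Θ (u ⊗ₜ HahnSeries.single (-(a + k)) 1)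
        (Θ (v ⊗ₜ HahnSeries.single (-(b + p - k)) 1) w) = ((-1 : ℂ) ^ h * (-1) ^ l) •
        ∑ i ∈ Finset.range I, ∑ j ∈ Finset.range J, modes Y (dividedPower 𝒱.L.Lone i u)
          (2 * h - 2 - i - a - p + p - k) (modes Y (dividedPower 𝒱.L.Lone j v)
            (2 * l - 2 - j - b - p + k) w) := by
      rw [hΘ, tauW_oppMap_single 𝒱 Y hu hI, tauW_oppMap_single 𝒱 Y hv hJ]
      simp only [LinearMap.smul_apply, LinearMap.sum_apply, map_smul, map_sum, Finset.smul_sum,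
        smul_smul]
      rw [Finset.sum_comm, mul_comm ((-1 : ℂ) ^ h)]
      refine Finset.sum_congr rfl fun i _ => Finset.sum_congr rfl fun j _ => ?_
      rw [show 2 * l - 2 - (j : ℤ) - b - p + k = 2 * l - 2 - j - (b + p - k) by ring,
        show 2 * h - 2 - (i : ℤ) - a - p + p - k = 2 * h - 2 - i - (a + k) by ring]
    rw [e1, e2]
    simp only [borcherdsTerm, Finset.sum_sub_distrib, ← Finset.smul_sum]
    set X := ∑ i ∈ Finset.range I, ∑ j ∈ Finset.range J, modes Y (dividedPower 𝒱.L.Lone i u)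
          (2 * h - 2 - i - a - p + p - k) (modes Y (dividedPower 𝒱.L.Lone j v)
            (2 * l - 2 - j - b - p + k) w)
    set X' := ∑ i ∈ Finset.range I, ∑ j ∈ Finset.range J, modes Y (dividedPower 𝒱.L.Lone j v)
          (2 * l - 2 - j - b - p + p - k) (modes Y (dividedPower 𝒱.L.Lone i u)
            (2 * h - 2 - i - a - p + k) w)
    have e3 : ((-1 : ℂ) ^ p * (-1) ^ h * (-1) ^ l) • ((-1) ^ p * altBinom p k) • X' =
        altBinom p k • ((-1 : ℂ) ^ h * (-1) ^ l) • X' := by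
      rw [smul_smul, smul_smul]
      congr 1
      linear_combination ((-1 : ℂ) ^ h * (-1) ^ l * altBinom p k) * hpp
    rw [smul_sub, smul_sub, e3]
    module
  -- Both sides are bilinear in `u` and `v`, so homogeneous vectors suffice.
  have hv : v ∈ ⨆ q : ℤ × A, 𝒱.gr q.1 q.2 := by rw [𝒱.gr_span]; trivial
  have hu : u ∈ ⨆ q : ℤ × A, 𝒱.gr q.1 q.2 := by rw [𝒱.gr_span]; trivial
  induction hu using Submodule.iSup_induction' with
  | zero => exact .of_forall_eq_zero fun k => by simp [modes]
  | add u u' _ _ h1 h2 =>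
    have := h1.add h2
    rw [add_zero] at this
    refine this.congr fun k => ?_
    simp only [modes_add, TensorProduct.add_tmul, map_add, LinearMap.add_apply, smul_add]
    abel
  | mem q u hu =>
    induction hv using Submodule.iSup_induction' with
    | zero => exact .of_forall_eq_zero fun k => by simp
    | add v v' _ _ h1 h2 =>
      have := h1.add h2
      rw [add_zero] at this
      refine this.congr fun k => ?_
      simp only [TensorProduct.add_tmul, map_add, LinearMap.add_apply, smul_add]
      abel
    | mem q' v hv => exact hhom q u hu q' v hv

end Opposite

/-! ## Rearranging products of modes on `(W₁ ⊗ W₂)*` -/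

theorem altBinom_zero_right (n : ℤ) : altBinom n 0 = 1 := by simp [altBinom, binom_zero_right]

theorem altBinom_zero_succ (k : ℕ) : altBinom 0 (k + 1) = 0 := by
  rw [altBinom, binom_zero_succ, mul_zero]

/-- Summation by parts: (x - y)^(p+1) is (x - y)^p times x - y. -/
theorem sum_range_altBinom (p : ℤ) (e : ℕ → ℂ) (K : ℕ) :
    ∑ k ∈ Finset.range (K + 1), altBinom (p + 1) k * e k =
      ∑ k ∈ Finset.range (K + 1), altBinom p k * (e k - e (k + 1)) + altBinom p K * e (K + 1) := by
  induction K with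
  | zero => simp [altBinom_zero_right]
  | succ K ih =>
    rw [Finset.sum_range_succ, ih, Finset.sum_range_succ _ (K + 1), altBinom_succ_succ]
    ring

/-- The boundary term of the summation by parts disappears because `e` has finite support. -/
theorem eventualSum_altBinom_iff (p : ℤ) {e : ℕ → ℂ} (he : ∃ K, ∀ k, K ≤ k → e k = 0) (s : ℂ) :
    EventualSum (fun k => altBinom p k * (e k - e (k + 1))) s ↔
      EventualSum (fun k => altBinom (p + 1) k * e k) s := by
  obtain ⟨K₀, hK₀⟩ := he
  have key : ∀ K, K₀ + 1 ≤ K → ∑ k ∈ Finset.range K, altBinom (p + 1) k * e k =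
      ∑ k ∈ Finset.range K, altBinom p k * (e k - e (k + 1)) := fun K hK => by
    obtain ⟨K, rfl⟩ := Nat.exists_eq_add_of_le' (show 1 ≤ K by omega)
    rw [sum_range_altBinom, hK₀ (K + 1) (by omega), mul_zero, add_zero]
  constructor
  · rintro ⟨K, hK⟩
    exact ⟨max K (K₀ + 1), fun k hk => by
      rw [key k (le_trans (le_max_right _ _) hk), hK k (le_trans (le_max_left _ _) hk)]⟩
  · rintro ⟨K, hK⟩
    exact ⟨max K (K₀ + 1), fun k hk => by
      rw [← key k (le_trans (le_max_right _ _) hk), hK k (le_trans (le_max_left _ _) hk)]⟩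

/-- Let `S i j`, `L a m b n`, `R a m b n` be the values on `t₁^i t₂^j` and on
`y₁^a t₁^m y₂^b t₂^n` of linear functionals, where `y = t + z`, such that `S = L - R`, and such that
all of them vanish on high powers of `t₂`. Then the expansion of `t₁^m t₂^n (t₁ - t₂)^p` for small
`t₂` can be replaced by the expansions for large and for small `y₁`. -/
theorem eventualSum_expansion {z : ℂ} {S : ℤ → ℤ → ℂ} {L R : ℤ → ℤ → ℤ → ℤ → ℂ} {N : ℤ}
    (hS : ∀ m n, S m n = L 0 m 0 n - R 0 m 0 n)
    (hL₁ : ∀ a m b n, L a (m + 1) b n = L (a + 1) m b n - z * L a m b n)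
    (hL₂ : ∀ a m b n, L a m b (n + 1) = L a m (b + 1) n - z * L a m b n)
    (hR₁ : ∀ a m b n, R a (m + 1) b n = R (a + 1) m b n - z * R a m b n)
    (hR₂ : ∀ a m b n, R a m b (n + 1) = R a m (b + 1) n - z * R a m b n)
    (hLN : ∀ a m b n, N ≤ n → L a m b n = 0) (hRN : ∀ a m b n, N ≤ n → R a m b n = 0)
    (hL : ∀ m, ∃ a₀, ∀ a b n, a ≤ a₀ → L a m b n = 0)
    (hR : ∀ m, ∃ a₀, ∀ a b n, a₀ ≤ a → R a m b n = 0) (p m n : ℤ) :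
    EventualSum (fun k : ℕ => altBinom p k *
      (S (m + p - k) (n + k) - L (p - k) m k n + (-1) ^ p * R k m (p - k) n)) 0 := by
  set e : ℤ → ℤ → ℤ → ℕ → ℂ := fun p m n k =>
    S (m + p - k) (n + k) - L (p - k) m k n + (-1) ^ p * R k m (p - k) n with he
  have hSN : ∀ m n, N ≤ n → S m n = 0 := fun m n hn => by
    rw [hS, hLN _ _ _ _ hn, hRN _ _ _ _ hn, sub_zero]
  have hez : ∀ p m n, ∃ K, ∀ k, K ≤ k → e p m n k = 0 := by
    intro p m n
    obtain ⟨a₀, ha₀⟩ := hL m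
    obtain ⟨a₁, ha₁⟩ := hR m
    -- The three summands bound `k` so that `S`, `L` and `R` vanish, in this order.
    refine ⟨(N - n).toNat + (p - a₀).toNat + a₁.toNat, fun k hk => ?_⟩
    rw [he]
    simp only
    rw [hSN _ _ (by omega), ha₀ _ _ _ (by omega), ha₁ _ _ _ (by omega)]
    ring
  -- Multiplication by t₁ - t₂ = y₁ - y₂: the multiples of `z` coming from t₁ and from t₂ cancel.
  have hrec : ∀ p m n k, altBinom p k * e p (m + 1) n k - altBinom p k * e p m (n + 1) k =
      altBinom p k * (e (p + 1) m n k - e (p + 1) m n (k + 1)) := by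
    intro p m n k
    simp only [he]
    rw [hL₁, hL₂, hR₁, hR₂]
    push_cast
    rw [show m + 1 + p - (k : ℤ) = m + (p + 1) - k by ring,
      show m + (p + 1) - ((k : ℤ) + 1) = m + p - k by ring,
      show n + 1 + (k : ℤ) = n + (k + 1) by ring, show p - (k : ℤ) + 1 = p + 1 - k by ring,
      show p + 1 - ((k : ℤ) + 1) = p - k by ring, zpow_add_one₀ (by norm_num)]
    ring
  have hstep : ∀ p m n, EventualSum (fun k => altBinom p k * e p (m + 1) n k) 0 →
      EventualSum (fun k => altBinom p k * e p m (n + 1) k) 0 →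
      EventualSum (fun k => altBinom (p + 1) k * e (p + 1) m n k) 0 := fun p m n h1 h2 => by
    have := h1.sub h2
    simp only [hrec, sub_zero] at this
    exact (eventualSum_altBinom_iff p (hez _ _ _) 0).mp this
  change EventualSum (fun k => altBinom p k * e p m n k) 0
  induction p using Int.induction_on generalizing m n with
  | zero =>
    have h0 : altBinom 0 0 * e 0 m n 0 = 0 := by simp [he, hS]
    have := EventualSum.single (c := fun k => altBinom 0 k * e 0 m n k)
      (fun k => by rw [altBinom_zero_succ, zero_mul])
    rwa [h0] at this
  | succ p ih => exact hstep p m n (ih _ _) (ih _ _)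
  | pred p ih =>
    -- For `n ≥ N` every term vanishes, uniformly in the power of y₂. This anchors the descent in
    -- `p`.
    have hhigh : ∀ m n, N ≤ n →
        EventualSum (fun k => altBinom (-p - 1) k * e (-p - 1) m n k) 0 := fun m n hn =>
      .of_forall_eq_zero fun k => by
        simp only [he]
        rw [hSN _ _ (by omega), hLN _ _ _ _ hn, hRN _ _ _ _ hn]
        ring
    -- The identity at exponent -p says that, at exponent -p-1, the sums for (m, n) and (m - 1, n +
    -- 1) agree. Hence `n` can be raised step by step until it reaches `N`.
    have hdown : ∀ (j : ℕ) m n, N ≤ n + j →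
        EventualSum (fun k => altBinom (-p - 1) k * e (-p - 1) m n k) 0 := by
      intro j
      induction j with
      | zero => exact fun m n hn => hhigh m n (by simpa using hn)
      | succ j ihj =>
        intro m n hn
        have h1 := ihj (m - 1) (n + 1) (by push_cast at hn; omega)
        have h2 := ih (m - 1) n
        have h3 := (eventualSum_altBinom_iff (-p - 1) (hez (-p - 1 + 1) (m - 1) n) 0).mpr
          (by rwa [sub_add_cancel])
        simp only [← hrec] at h3
        have := h3.add h1
        simpa only [sub_add_cancel, add_zero] using this
    exact hdown (N - n).toNat m n (by omega)

/-! ## The action `τ_{Q(z)}` -/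

theorem substRat_X (s : LaurentSeries ℂ) (hs : Transcendental ℂ s) :
    substRat s hs RatFunc.X = s := by
  rw [← RatFunc.algebraMap_X, substRat, RatFunc.liftAlgHom_apply]
  simp

theorem single_zpow_one (i n : ℤ) :
    (HahnSeries.single i 1 : LaurentSeries ℂ) ^ n = HahnSeries.single (n * i) 1 := by
  obtain ⟨k, rfl | rfl⟩ := n.eq_nat_or_neg
  · rw [zpow_natCast, HahnSeries.single_pow, one_pow, nsmul_eq_mul]
  · rw [zpow_neg, zpow_natCast, HahnSeries.single_pow, HahnSeries.inv_single, one_pow, inv_one,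
      nsmul_eq_mul, neg_mul]

theorem substRat_locElem {s : LaurentSeries ℂ} (hs : Transcendental ℂ s) (z : ℂ) (m n : ℤ) :
    substRat s hs (locElem z m n : RatFunc ℂ) = (s + HahnSeries.C z) ^ m * s ^ n := by
  have hC : substRat s hs (RatFunc.C z) = HahnSeries.C z := by
    rw [← RatFunc.algebraMap_eq_C]
    exact (substRat s hs).commutes z
  rw [locElem, map_mul, map_zpow₀, map_zpow₀, map_add, substRat_X, hC, add_comm]

/-- The substitution t ↦ t - z makes y = z + t the variable of the Laurent series, and t itself
becomes y - z. -/
theorem expandPlus_locElem (z : ℂ) (m n : ℤ) :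
    expandPlus z (locElem z m n : RatFunc ℂ) = HahnSeries.single m 1 * shiftVar 1 z ^ n := by
  rw [expandPlus, substRat_locElem, sub_add_cancel, single_zpow_one, mul_one, shiftVar]

theorem expandMinus_locElem (z : ℂ) (m n : ℤ) :
    expandMinus z (locElem z m n : RatFunc ℂ) = HahnSeries.single (-m) 1 * shiftVar (-1) z ^ n := by
  rw [expandMinus, substRat_locElem, sub_add_cancel, single_zpow_one, mul_neg_one, shiftVar]

theorem locElem_succ (z : ℂ) (m n : ℤ) :
    locElem z m (n + 1) = locElem z (m + 1) n - z • locElem z m n := by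
  have hX : (RatFunc.X : RatFunc ℂ) ≠ 0 := RatFunc.X_ne_zero
  have hZ : RatFunc.C z + RatFunc.X ≠ (0 : RatFunc ℂ) := by
    rw [← RatFunc.algebraMap_C, ← RatFunc.algebraMap_X, ← map_add]
    refine RatFunc.algebraMap_ne_zero fun h => ?_
    rw [add_comm] at h
    exact Polynomial.X_add_C_ne_zero z h
  apply Subtype.ext
  rw [Subalgebra.coe_sub, Subalgebra.coe_smul]
  simp only [locElem]
  rw [zpow_add_one₀ hX, zpow_add_one₀ hZ, Algebra.smul_def, RatFunc.algebraMap_eq_C]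
  ring

section Qz

variable {G V : Type*} [AddCommGroup G] {A : AddSubgroup G} [AddCommGroup V] [Module ℂ V]
  {𝒱 : MobiusVertexAlgebra A V} {W₁ W₂ : Type*} [AddCommGroup W₁] [Module ℂ W₁]
  [AddCommGroup W₂] [Module ℂ W₂]

/-- The action of `v ⊗ (z + t)^m t^n` on `W₁` through `T^o_{-z}`. -/
def actOpp (z : ℂ) (M₁ : MobiusModule 𝒱 W₁) (v : V) (m n : ℤ) : Module.End ℂ W₁ :=
  (tauW M₁.Y ∘ₗ oppMap 𝒱) (v ⊗ₜ (HahnSeries.single (-m) 1 * shiftVar (-1) z ^ n))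

/-- The action of `v ⊗ (z + t)^m t^n` on `W₂` through `T⁺_{-z}`. -/
def actPlus (z : ℂ) (M₂ : MobiusModule 𝒱 W₂) (v : V) (m n : ℤ) : Module.End ℂ W₂ :=
  tauW M₂.Y (v ⊗ₜ (HahnSeries.single m 1 * shiftVar 1 z ^ n))

theorem tauQ_locElem_apply (z : ℂ) (M₁ : MobiusModule 𝒱 W₁) (M₂ : MobiusModule 𝒱 W₂) (v : V)
    (m n : ℤ) (lam : Module.Dual ℂ (W₁ ⊗[ℂ] W₂)) (w₁ : W₁) (w₂ : W₂) :
    tauQ z M₁ M₂ (v ⊗ₜ locElem z m n) lam (w₁ ⊗ₜ w₂) =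
      lam (actOpp z M₁ v m n w₁ ⊗ₜ w₂) - lam (w₁ ⊗ₜ actPlus z M₂ v m n w₂) := by
  rw [actOpp, actPlus, ← expandMinus_locElem, ← expandPlus_locElem, ← map_sub]
  rfl

/-- Exhibits the operator as linear in the rational function, so that the relation t = y - z can be
transported from `locElem_succ`. -/
theorem actOpp_eq_tauW (z : ℂ) (M₁ : MobiusModule 𝒱 W₁) (v : V) (m n : ℤ) :
    actOpp z M₁ v m n =
      (tauW M₁.Y ∘ₗ oppMap 𝒱 ∘ₗ LinearMap.lTensor V
        ((expandMinus z).comp (locAlg z).val).toLinearMap) (v ⊗ₜ locElem z m n) := by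
  rw [actOpp, ← expandMinus_locElem]
  rfl

theorem actPlus_eq_tauW (z : ℂ) (M₂ : MobiusModule 𝒱 W₂) (v : V) (m n : ℤ) :
    actPlus z M₂ v m n =
      (tauW M₂.Y ∘ₗ LinearMap.lTensor V
        ((expandPlus z).comp (locAlg z).val).toLinearMap) (v ⊗ₜ locElem z m n) := by
  rw [actPlus, ← expandPlus_locElem]
  rfl

theorem actOpp_succ (z : ℂ) (M₁ : MobiusModule 𝒱 W₁) (v : V) (m n : ℤ) :
    actOpp z M₁ v m (n + 1) = actOpp z M₁ v (m + 1) n - z • actOpp z M₁ v m n := by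
  rw [actOpp_eq_tauW, actOpp_eq_tauW, actOpp_eq_tauW, locElem_succ, TensorProduct.tmul_sub,
    TensorProduct.tmul_smul, map_sub, map_smul]

theorem actPlus_succ (z : ℂ) (M₂ : MobiusModule 𝒱 W₂) (v : V) (m n : ℤ) :
    actPlus z M₂ v m (n + 1) = actPlus z M₂ v (m + 1) n - z • actPlus z M₂ v m n := by
  rw [actPlus_eq_tauW, actPlus_eq_tauW, actPlus_eq_tauW, locElem_succ, TensorProduct.tmul_sub,
    TensorProduct.tmul_smul, map_sub, map_smul]

theorem tauQ_locElem_succ (z : ℂ) (M₁ : MobiusModule 𝒱 W₁) (M₂ : MobiusModule 𝒱 W₂) (v : V)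
    (m n : ℤ) : tauQ z M₁ M₂ (v ⊗ₜ locElem z m (n + 1)) =
      tauQ z M₁ M₂ (v ⊗ₜ locElem z (m + 1) n) - z • tauQ z M₁ M₂ (v ⊗ₜ locElem z m n) := by
  rw [locElem_succ, TensorProduct.tmul_sub, TensorProduct.tmul_smul, map_sub, map_smul]

/-- Under the compatibility condition, the elements `v ⊗ (z + t)^m t^n` annihilate `lam` for all
large `n`, uniformly in `m`. -/
theorem QzCompatible.exists_tauQ_eq_zero {z : ℂ} {M₁ : MobiusModule 𝒱 W₁} {M₂ : MobiusModule 𝒱 W₂}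
    {lam : Module.Dual ℂ (W₁ ⊗[ℂ] W₂)} (h : QzCompatible z M₁ M₂ lam) (v : V) :
    ∃ N : ℤ, ∀ m n, N ≤ n → tauQ z M₁ M₂ (v ⊗ₜ locElem z m n) lam = 0 := by
  obtain ⟨N, hN⟩ := h.lower_truncation v
  refine ⟨N, fun m n hn => ?_⟩
  have := congrFun (h.compatibility v) ![-n - 1, -m - 1]
  have e : tauQ z M₁ M₂ (deltaYt z v ![-n - 1, -m - 1]) lam =
      tauQ z M₁ M₂ (v ⊗ₜ locElem z m n) lam := by
    simp [deltaYt]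
  rw [← e, this, formalMul]
  -- The delta function contains only nonnegative powers of x₀, so only modes of `v` of index at
  -- least `n ≥ N` contribute, whatever `m` is.
  refine finsum_eq_zero_of_forall_eq_zero fun q => ?_
  rw [deltaTwo]
  split_ifs with h0 h1 h1
  · rw [hN _ ?_, smul_zero]
    simp only [Pi.sub_apply, Matrix.cons_val_zero]
    omega
  · exact smul_zero _
  · exact zero_smul _ _
  · exact zero_smul _ _

/-- The Borcherds identity for opposite vertex operators and powers of `t = y - z`, expanded for
large `y`. -/
theorem eventualSum_actOpp (z : ℂ) (M₁ : MobiusModule 𝒱 W₁) (u v : V) (w : W₁) (p m n : ℤ) :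
    EventualSum (fun k : ℕ =>
      altBinom p k • actOpp z M₁ v k n (actOpp z M₁ u (p - k) m w) -
      ((-1) ^ p * altBinom p k) • actOpp z M₁ u k m (actOpp z M₁ v (p - k) n w) -
      binom m k • actOpp z M₁ (modes 𝒱.Y u (p + k) v) 0 (m + n - k) w) 0 := by
  obtain ⟨N, hN⟩ := modes_trunc 𝒱.Y u v
  have := (continuousAction_tauW_oppMap 𝒱 M₁.Y).borcherds_opposite u v
    (fun l => modes 𝒱.Y u l v) p w ⟨(N - p).toNat, fun k hk => hN _ (by omega)⟩
    (fun a b => borcherds_opposite 𝒱 M₁.Y M₁.jacobi u v w p a b) z m n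
  refine this.congr fun k => ?_
  have h1 : (HahnSeries.single (-(0 : ℤ)) 1 : LaurentSeries ℂ) = 1 := by rw [neg_zero]; rfl
  simp only [actOpp, h1, one_mul]

/-- The Borcherds identity for powers of `t = y - z`, expanded for small `y`. -/
theorem eventualSum_actPlus (z : ℂ) (M₂ : MobiusModule 𝒱 W₂) (u v : V) (w : W₂) (p m n : ℤ) :
    EventualSum (fun k : ℕ =>
      altBinom p k • actPlus z M₂ u (p - k) m (actPlus z M₂ v k n w) -
      ((-1) ^ p * altBinom p k) • actPlus z M₂ v (p - k) n (actPlus z M₂ u k m w) -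
      binom m k • actPlus z M₂ (modes 𝒱.Y u (p + k) v) 0 (m + n - k) w) 0 := by
  obtain ⟨N, hN⟩ := modes_trunc 𝒱.Y u v
  have hJ := (jacobi_iff (modes 𝒱.Y) (modes M₂.Y) u v w (modes_trunc M₂.Y u w)
    (modes_trunc M₂.Y v w) ⟨N, fun l n hl => by rw [hN l hl]; simp [modes]⟩).mp (M₂.jacobi u v w)
  have := (continuousAction_tauW M₂.Y).borcherds u v
    (fun l => modes 𝒱.Y u l v) p w ⟨(N - p).toNat, fun k hk => hN _ (by omega)⟩
    (fun a b => (hJ p a b).congr fun k => by simp only [borcherdsTerm, tauW_tmul_single]) z m n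
  refine this.congr fun k => ?_
  have h1 : (HahnSeries.single (0 : ℤ) 1 : LaurentSeries ℂ) = 1 := rfl
  simp only [actPlus, h1, one_mul]

/-! ### Truncation on the two tensor factors and the Jacobi identity on compatible functionals -/

theorem exists_actOpp_eq_zero (z : ℂ) (M₁ : MobiusModule 𝒱 W₁) (v : V) (n : ℤ) (w : W₁) :
    ∃ m₀, ∀ m, m ≤ m₀ → actOpp z M₁ v m n w = 0 := by
  obtain ⟨M, hM⟩ := continuousAction_tauW_oppMap 𝒱 M₁.Y v w
  obtain ⟨γ, hγ⟩ := exists_vanishesBelow (shiftVar (-1) z ^ n)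
  exact ⟨γ - M, fun m hm => hM _ (((vanishesBelow_single _ _).mul hγ).mono (by omega))⟩

theorem exists_actPlus_eq_zero (z : ℂ) (M₂ : MobiusModule 𝒱 W₂) (v : V) (n : ℤ) (w : W₂) :
    ∃ m₀, ∀ m, m₀ ≤ m → actPlus z M₂ v m n w = 0 := by
  obtain ⟨M, hM⟩ := continuousAction_tauW M₂.Y v w
  obtain ⟨γ, hγ⟩ := exists_vanishesBelow (shiftVar 1 z ^ n)
  exact ⟨M - γ, fun m hm => hM _ (((vanishesBelow_single _ _).mul hγ).mono (by omega))⟩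

/-- The products of modes of `Y'_{Q(z)}` acting on a compatible functional, in terms of the
expansions in `y₁` of the factors acting on `W₁` and `W₂`. -/
theorem QzCompatible.eventualSum_YQ {z : ℂ} {M₁ : MobiusModule 𝒱 W₁} {M₂ : MobiusModule 𝒱 W₂}
    {lam : Module.Dual ℂ (W₁ ⊗[ℂ] W₂)} (h : QzCompatible z M₁ M₂ lam) (u v : V) (w₁ : W₁) (w₂ : W₂)
    (p m n : ℤ) :
    EventualSum (fun k : ℕ => altBinom p k *
      (YQ z M₁ M₂ u (m + p - k) (YQ z M₁ M₂ v (n + k) lam) (w₁ ⊗ₜ w₂) -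
      tauQ z M₁ M₂ (v ⊗ₜ locElem z k n) lam (actOpp z M₁ u (p - k) m w₁ ⊗ₜ w₂) +
      (-1) ^ p * tauQ z M₁ M₂ (v ⊗ₜ locElem z (p - k) n) lam
        (w₁ ⊗ₜ actPlus z M₂ u k m w₂))) 0 := by
  obtain ⟨N, hN⟩ := h.exists_tauQ_eq_zero v
  refine eventualSum_expansion (z := z) (N := N)
    (S := fun i j => YQ z M₁ M₂ u i (YQ z M₁ M₂ v j lam) (w₁ ⊗ₜ w₂))
    (L := fun a m b n => tauQ z M₁ M₂ (v ⊗ₜ locElem z b n) lam (actOpp z M₁ u a m w₁ ⊗ₜ w₂))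
    (R := fun a m b n => tauQ z M₁ M₂ (v ⊗ₜ locElem z b n) lam (w₁ ⊗ₜ actPlus z M₂ u a m w₂))
    ?_ ?_ ?_ ?_ ?_ ?_ ?_ ?_ ?_ p m n
  · intro m n
    exact tauQ_locElem_apply z M₁ M₂ u 0 m _ w₁ w₂
  · intro a m b n
    simp only [actOpp_succ, LinearMap.sub_apply, LinearMap.smul_apply, TensorProduct.sub_tmul,
      ← TensorProduct.smul_tmul', map_sub, map_smul, smul_eq_mul]
  · intro a m b n
    simp only [tauQ_locElem_succ, LinearMap.sub_apply, LinearMap.smul_apply, smul_eq_mul]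
  · intro a m b n
    simp only [actPlus_succ, LinearMap.sub_apply, LinearMap.smul_apply, TensorProduct.tmul_sub,
      TensorProduct.tmul_smul, map_sub, map_smul, smul_eq_mul]
  · intro a m b n
    simp only [tauQ_locElem_succ, LinearMap.sub_apply, LinearMap.smul_apply, smul_eq_mul]
  · intro a m b n hn
    simp only [hN b n hn, LinearMap.zero_apply]
  · intro a m b n hn
    simp only [hN b n hn, LinearMap.zero_apply]
  · intro m
    obtain ⟨a₀, ha₀⟩ := exists_actOpp_eq_zero z M₁ u m w₁
    exact ⟨a₀, fun a b n ha => by simp only [ha₀ a ha, TensorProduct.zero_tmul, map_zero]⟩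
  · intro m
    obtain ⟨a₀, ha₀⟩ := exists_actPlus_eq_zero z M₂ u m w₂
    exact ⟨a₀, fun a b n ha => by simp only [ha₀ a ha, TensorProduct.tmul_zero, map_zero]⟩

theorem YQ_zero (z : ℂ) (M₁ : MobiusModule 𝒱 W₁) (M₂ : MobiusModule 𝒱 W₂) (n : ℤ) :
    YQ z M₁ M₂ 0 n = 0 := by
  rw [YQ, TensorProduct.zero_tmul, map_zero]

/-- The Borcherds identity acting on a compatible functional, evaluated at a pure tensor. -/
theorem QzCompatible.eventualSum_borcherdsTerm {z : ℂ} {M₁ : MobiusModule 𝒱 W₁}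
    {M₂ : MobiusModule 𝒱 W₂} {lam : Module.Dual ℂ (W₁ ⊗[ℂ] W₂)} (h : QzCompatible z M₁ M₂ lam)
    (u v : V) (w₁ : W₁) (w₂ : W₂) (p m n : ℤ) :
    EventualSum (fun k => borcherdsTerm (modes 𝒱.Y) (YQ z M₁ M₂) u v lam p m n k (w₁ ⊗ₜ w₂)) 0 := by
  have h1 := h.eventualSum_YQ u v w₁ w₂ p m n
  -- The same rearrangement for the reversed product: `u` and `v`, and with them `m` and `n`, are
  -- exchanged, and (-1)^p relates (t₂ - t₁)^p to (t₁ - t₂)^p.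
  have h2 := (h.eventualSum_YQ v u w₁ w₂ p n m).const_smul ((-1 : ℂ) ^ p)
  have h3 := (eventualSum_actOpp z M₁ u v w₁ p m n).map
    (lam ∘ₗ (TensorProduct.mk ℂ W₁ W₂).flip w₂).toAddMonoidHom
  have h4 := (eventualSum_actPlus z M₂ u v w₂ p m n).map
    (lam ∘ₗ TensorProduct.mk ℂ W₁ W₂ w₁).toAddMonoidHom
  have := ((h1.sub h2).add h3).sub h4
  simp only [map_zero, smul_zero, sub_zero, add_zero] at this
  refine this.congr fun k => ?_
  have hpp : (-1 : ℂ) ^ p * (-1) ^ p = 1 := by rw [← mul_zpow]; norm_num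
  have h5 : YQ z M₁ M₂ (modes 𝒱.Y u (p + k) v) (m + n - k) lam (w₁ ⊗ₜ w₂) = _ :=
    tauQ_locElem_apply z M₁ M₂ (modes 𝒱.Y u (p + k) v) 0 (m + n - k) lam w₁ w₂
  rw [borcherdsTerm]
  simp only [LinearMap.sub_apply, LinearMap.smul_apply, smul_eq_mul, h5, tauQ_locElem_apply,
    LinearMap.toAddMonoidHom_coe, LinearMap.comp_apply, LinearMap.flip_apply,
    TensorProduct.mk_apply, map_sub, map_smul]
  -- Once both sides are expanded, the mixed terms, with one factor on each of W₁ and W₂, cancel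
  -- because ((-1)^p)² = 1.
  linear_combination -(altBinom p k * (lam (actOpp z M₁ u (p - k) m w₁ ⊗ₜ actPlus z M₂ v k n w₂) -
    lam (w₁ ⊗ₜ actPlus z M₂ u (p - k) m (actPlus z M₂ v k n w₂)))) * hpp

/-- The Jacobi identity for `Y'_{Q(z)}` acting on a compatible functional. -/
theorem QzCompatible.jacobi {z : ℂ} {M₁ : MobiusModule 𝒱 W₁} {M₂ : MobiusModule 𝒱 W₂}
    {lam : Module.Dual ℂ (W₁ ⊗[ℂ] W₂)} (h : QzCompatible z M₁ M₂ lam) (u v : V) :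
    Jacobi (modes 𝒱.Y) (YQ z M₁ M₂) u v lam := by
  obtain ⟨N, hN⟩ := modes_trunc 𝒱.Y u v
  obtain ⟨Nu, hNu⟩ := h.lower_truncation u
  obtain ⟨Nv, hNv⟩ := h.lower_truncation v
  refine (jacobi_iff (modes 𝒱.Y) (YQ z M₁ M₂) u v lam ⟨Nu, hNu⟩ ⟨Nv, hNv⟩
    ⟨N, fun l n hl => by rw [hN l hl, YQ_zero, LinearMap.zero_apply]⟩).mpr fun p m n => ?_
  -- Truncation on `lam` gives a cutoff independent of the tensors w₁ ⊗ w₂, so the sum of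
  -- functionals exists; the cutoffs in the evaluated identity depend on `w₁` and `w₂`.
  have hs := EventualSum.of_forall_ge (c := borcherdsTerm (modes 𝒱.Y) (YQ z M₁ M₂) u v lam p m n)
    (K₀ := (N - p).toNat + (Nu - m).toNat + (Nv - n).toNat) fun k hk => by
      rw [borcherdsTerm, hNv _ (by omega), hNu _ (by omega), hN _ (by omega), YQ_zero]
      simp
  -- It remains to see that the sum is the zero functional, which is tested on pure tensors through
  -- uniqueness of eventual sums.
  convert hs
  refine TensorProduct.ext' fun w₁ w₂ => ?_
  have h1 := hs.map ((Module.Dual.eval ℂ _ (w₁ ⊗ₜ[ℂ] w₂)).toAddMonoidHom)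
  exact (h.eventualSum_borcherdsTerm u v w₁ w₂ p m n).unique h1

end Qz

end QzTensor

end

/-! ### The Möbius and the conformal case -/

theorem mainTheorem7 {G : Type*} [AddCommGroup G] (A : AddSubgroup G)
    {V W₁ W₂ : Type*} [AddCommGroup V] [Module ℂ V] [AddCommGroup W₁] [Module ℂ W₁]
    [AddCommGroup W₂] [Module ℂ W₂] (z : ℂ) (hz : z ≠ 0) :
    (∀ (𝒱 : QzTensor.MobiusVertexAlgebra A V) (M₁ : QzTensor.MobiusModule 𝒱 W₁)
        (M₂ : QzTensor.MobiusModule 𝒱 W₂) (lam : Module.Dual ℂ (W₁ ⊗[ℂ] W₂)),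
        QzTensor.QzCompatible z M₁ M₂ lam →
        ∀ u v : V,
          QzTensor.Jacobi (QzTensor.modes 𝒱.Y) (QzTensor.YQ z M₁ M₂) u v lam) ∧
    (∀ (𝒱 : QzTensor.ConformalVertexAlgebra A V) (M₁ : QzTensor.ConformalModule 𝒱 W₁)
        (M₂ : QzTensor.ConformalModule 𝒱 W₂) (lam : Module.Dual ℂ (W₁ ⊗[ℂ] W₂)),
        QzTensor.QzCompatible z M₁.toMobius M₂.toMobius lam →
        ∀ u v : V,
          QzTensor.Jacobi (QzTensor.modes 𝒱.Y) (QzTensor.YQ z M₁.toMobius M₂.toMobius)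
            u v lam) :=
  -- The conformal case is the Möbius one for the associated structures, whose vertex operators are
  -- by definition the same.
  ⟨fun _ _ _ _ h u v => h.jacobi u v, fun _ _ _ _ h u v => h.jacobi u v⟩
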